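/- Let $G$ be a finite undirected unweighted graph on $n\ge 1$ vertices, without loops, parallel edges being allowed. The weight of a cut $(S,V\setminus S)$ is the sum of the weights of the edges with exactly one endpoint in $S$, where every edge of $G$ has weight $1$. A skeleton of $G$ is a subgraph of $G$ on the same vertex set with arbitrary edge weights, and for $\epsilon\in(0,1]$ the set $(1\pm\epsilon)G$ consists of the skeletons in which the weight of every cut is at least $(1-\epsilon)$ times and at most $(1+\epsilon)$ times its weight in $G$. The standard connectivity $k_e$ of an edge $e=(u,v)$ is the value of a maximum flow between $u$ and $v$ in $G$, every edge having capacity $1$. Put $$p_e=\min\left(\frac{96\,(3+\log_2 n)\,\ln n}{0.38\,k_e\,\epsilon^2},\,1\right).$$ Let $G_\epsilon$ be the random skeleton obtained by selecting each edge $e$ of $G$ independently with probability $p_e$ and giving each selected edge $e$ the weight $1/p_e$. Theorem. There are absolute constants $C,D>0$ and an integer $d\ge 1$ such that for every such $G$ and every $\epsilon\in(0,1]$: (1) the expected number of edges of $G_\epsilon$ is at most $C\,n\ln^2 n/\epsilon^2$; (2) $G_\epsilon\in(1\pm\epsilon)G$ with high probability, that is, $\Pr[G_\epsilon\notin(1\pm\epsilon)G]\le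 D/n^{d}$. -/

import Mathlib

open MeasureTheory ProbabilityTheory
open scoped Graph unitInterval

universe u v

namespace CutSparsifier

variable {α β : Type*}

/-- `f e u v` is the net flow sent along the edge `e` from `u` to `v`.  `IsFlow G s t f` says that
`f` is a feasible flow between `s` and `t` in the undirected graph `G`, all of whose edges have
capacity one. -/
structure IsFlow (G : Graph α β) [Fintype V(G)] [Fintype E(G)] (s t : V(G))
    (f : E(G) → V(G) → V(G) → ℝ) : Prop where
  antisymm : ∀ (e : E(G)) (u v : V(G)), f e u v = -f e v u
  support : ∀ (e : E(G)) (u v : V(G)), ¬ G.IsLink e u v → f e u v = 0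
  capacity : ∀ (e : E(G)) (u v : V(G)), f e u v ≤ 1
  conservation : ∀ u : V(G), u ≠ s → u ≠ t → ∑ e, ∑ v, f e u v = 0

/-- The value of a flow with source `s`: the net flow out of `s`. -/
def flowValue (G : Graph α β) [Fintype V(G)] [Fintype E(G)] (s : V(G))
    (f : E(G) → V(G) → V(G) → ℝ) : ℝ :=
  ∑ e, ∑ v, f e s v

/-- The standard connectivity `k_e` of an edge `e`: the maximum value of a flow between the two
ends of `e`. -/
noncomputable def connectivity (G : Graph α β) [Fintype V(G)] [Fintype E(G)] (e : E(G)) : ℝ :=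
  sSup {r : ℝ | ∃ s t : V(G), G.IsLink e s t ∧
    ∃ f : E(G) → V(G) → V(G) → ℝ, IsFlow G s t f ∧ flowValue G s f = r}

/-- The probability `p_e` with which the edge `e` is sampled. -/
noncomputable def sampleProb (G : Graph α β) [Fintype V(G)] [Fintype E(G)] (ε : ℝ) (e : E(G)) : ℝ :=
  min (96 * (3 + Real.logb 2 (Fintype.card V(G))) * Real.log (Fintype.card V(G)) /
    (0.38 * connectivity G e * ε ^ 2)) 1

theorem connectivity_nonneg (G : Graph α β) [Fintype V(G)] [Fintype E(G)] (e : E(G)) :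
    0 ≤ connectivity G e := by
  apply Real.sSup_nonneg'
  obtain ⟨x, y, h⟩ := Graph.exists_isLink_of_mem_edgeSet e.2
  refine ⟨0, ⟨⟨x, h.left_mem⟩, ⟨y, h.right_mem⟩, h, fun _ _ _ => 0, ⟨?_, ?_, ?_, ?_⟩, ?_⟩, le_rfl⟩
  all_goals simp [flowValue]

theorem sampleProb_mem (G : Graph α β) [Fintype V(G)] [Fintype E(G)] (ε : ℝ) (e : E(G)) :
    sampleProb G ε e ∈ I := by
  have h0 := connectivity_nonneg G e
  have h1 : 0 ≤ Real.log (Fintype.card V(G)) := Real.log_natCast_nonneg _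
  have h2 : 0 ≤ Real.logb 2 (Fintype.card V(G)) :=
    div_nonneg h1 (Real.log_nonneg (by norm_num))
  exact ⟨le_min (by positivity) zero_le_one, min_le_right _ _⟩

/-- A skeleton of `G`: a subgraph on the same vertex set, given by its set of edges, together with
arbitrary edge weights (only the weights of the edges of the skeleton matter). -/
structure Skeleton (G : Graph α β) where
  edges : Set E(G)
  weight : E(G) → ℝ

/-- The edge `e` crosses the cut `(S, V(G) \ S)`. -/
def Crosses (G : Graph α β) (S : Set V(G)) (e : E(G)) : Prop :=
  ∃ u v : V(G), G.IsLink e u v ∧ u ∈ S ∧ v ∉ S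

open Classical in
/-- The weight, in the skeleton `H` of `G`, of the cut `(S, V(G) \ S)`. -/
noncomputable def Skeleton.cutWeight {G : Graph α β} [Fintype E(G)] (H : Skeleton G)
    (S : Set V(G)) : ℝ :=
  ∑ e with e ∈ H.edges ∧ Crosses G S e, H.weight e

/-- The graph `G` itself, as a skeleton with unit edge weights. -/
def Skeleton.full (G : Graph α β) : Skeleton G where
  edges := Set.univ
  weight := fun _ => 1

/-- The set `(1 ± ε)G` of all weighted subgraphs of `G` in which the weight of every cut is within
a factor `1 ± ε` of the weight of the corresponding cut of `G`. -/
def approx (G : Graph α β) [Fintype E(G)] (ε : ℝ) : Set (Skeleton G) :=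
  {H | ∀ S : Set V(G),
    (1 - ε) * (Skeleton.full G).cutWeight S ≤ H.cutWeight S ∧
    H.cutWeight S ≤ (1 + ε) * (Skeleton.full G).cutWeight S}

/-- The law of the independent coin tosses: the coin of the edge `e` shows `true` with probability
`p_e`, independently of the other edges. -/
noncomputable def sampleLaw (G : Graph α β) [Fintype V(G)] [Fintype E(G)] (ε : ℝ) :
    Measure (E(G) → Bool) :=
  Measure.pi fun e => bernoulliMeasure true false (⟨sampleProb G ε e, sampleProb_mem G ε e⟩ : I)

/-- The skeleton `G_ε` determined by the coin tosses `ω`: it consists of the sampled edges, and a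
sampled edge `e` has weight `1 / p_e`. -/
noncomputable def sampledSkeleton (G : Graph α β) [Fintype V(G)] [Fintype E(G)] (ε : ℝ)
    (ω : E(G) → Bool) : Skeleton G where
  edges := {e | ω e = true}
  weight := fun e => 1 / sampleProb G ε e

end CutSparsifier

/-! Max-flow min-cut (`connectivity_eq_edgeConn`) turns `k_e` into the size of a smallest cut
through `e`. The size bound then follows from `∑ 1 / k_e ≤ n` (`sum_inv_edgeConn_le`), since `p_e`
is at most a fixed rate divided by `k_e`.

For concentration, the edges are grouped into classes with connectivity in `[2 ^ i, 2 ^ (i + 1))`. A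
cut may contain very few edges of a class, so its deviation there is measured also against the
number of its edges in layer `i`, a window among the first `2 ^ i` levels of a decomposition into
spanning forests. A cut meeting class `i` has at least `2 ^ i / 2` edges in layer `i`
(`IsForestLevel.two_pow_le`), and every edge lies in at most `log₂ n + 2` layers (`card_layers_le`).
Hence the errors tolerated in the classes add up to at most `ε` times the cut.

It remains to make a union bound affordable. Cuts with about `b * 2 ^ i / 4` edges in layer `i`
leave at most `(2n) ^ (b + 1)` distinct traces on class `i` (`card_traces_le`), while one trace
exceeds its tolerance with probability at most `2 / n ^ (7b)` (`measure_tolerance_lt_le`). The count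
is Karger's contraction argument in averaged form. It needs many edges per remaining terminal, which
is achieved by first splitting off all edges at non-terminals in the manner of Lovász and Mader
(`exists_splitting_off`, `card_small_cuts_le`). Summing over `b` and over at most `n ^ 2` classes
leaves `4 / n`. -/

/-! ### Splitting off and counting small cuts in multigraphs -/

namespace CutSparsifier

section CutCounting

open Classical

variable {V : Type*}

/-- The pair `e` is separated by the vertex set `X`. -/
def SplitBy (X : Set V) (e : Sym2 V) : Prop := ∃ a b, e = s(a, b) ∧ a ∈ X ∧ b ∉ X

@[simp]
theorem splitBy_mk {X : Set V} {a b : V} : SplitBy X s(a, b) ↔ ¬ (a ∈ X ↔ b ∈ X) := by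
  constructor
  · rintro ⟨c, d, h, hc, hd⟩
    rcases Sym2.eq_iff.1 h with ⟨rfl, rfl⟩ | ⟨rfl, rfl⟩ <;> tauto
  · intro h
    by_cases ha : a ∈ X
    · exact ⟨a, b, rfl, ha, by tauto⟩
    · exact ⟨b, a, Sym2.eq_swap, by tauto, ha⟩

/-- The number of edges of the multigraph with edge multiset `E` that cross the cut `X`. -/
noncomputable def cutSize (E : Multiset (Sym2 V)) (X : Set V) : ℕ := E.countP (SplitBy X)

theorem cutSize_cons (e : Sym2 V) (E : Multiset (Sym2 V)) (X : Set V) :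
    cutSize (e ::ₘ E) X = cutSize E X + if SplitBy X e then 1 else 0 :=
  Multiset.countP_cons _ _ _

theorem splitBy_compl {X : Set V} {e : Sym2 V} : SplitBy Xᶜ e ↔ SplitBy X e := by
  induction e with
  | h a b => simp only [splitBy_mk, Set.mem_compl_iff]; tauto

theorem cutSize_compl (E : Multiset (Sym2 V)) (X : Set V) : cutSize E Xᶜ = cutSize E X := by
  simp only [cutSize, splitBy_compl]

theorem cutSize_inter_add_union_le (E : Multiset (Sym2 V)) (X Y : Set V) :
    cutSize E (X ∩ Y) + cutSize E (X ∪ Y) ≤ cutSize E X + cutSize E Y := by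
  induction E using Multiset.induction with
  | empty => simp [cutSize]
  | cons e E ih =>
    simp only [cutSize_cons]
    have : ((if SplitBy (X ∩ Y) e then 1 else 0) + if SplitBy (X ∪ Y) e then 1 else 0) ≤
        (if SplitBy X e then 1 else 0) + if SplitBy Y e then 1 else 0 := by
      induction e with
      | h a b =>
        simp only [splitBy_mk, Set.mem_inter_iff, Set.mem_union]
        by_cases h1 : a ∈ X <;> by_cases h2 : a ∈ Y <;> by_cases h3 : b ∈ X <;>
          by_cases h4 : b ∈ Y <;> simp [h1, h2, h3, h4]
    omega

/-- Submodularity for `X` and `Yᶜ`, with the union replaced by its complement. -/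
theorem cutSize_diff_add_diff_le (E : Multiset (Sym2 V)) (X Y : Set V) :
    cutSize E (X \ Y) + cutSize E (Y \ X) ≤ cutSize E X + cutSize E Y := by
  have h := cutSize_inter_add_union_le E X Yᶜ
  rwa [← cutSize_compl E (X ∪ Yᶜ), cutSize_compl E Y, Set.compl_union, compl_compl,
    Set.inter_comm Xᶜ, ← Set.sdiff_eq, ← Set.sdiff_eq] at h

theorem countP_le_countP {ι : Type*} {p q : ι → Prop} {E : Multiset ι}
    (h : ∀ e ∈ E, p e → q e) : E.countP p ≤ E.countP q := by
  induction E using Multiset.induction with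
  | empty => simp
  | cons e E ih =>
    simp only [Multiset.countP_cons]
    have h1 := ih fun e' he' => h e' (Multiset.mem_cons_of_mem he')
    have h2 := h e (Multiset.mem_cons_self _ _)
    split_ifs <;> first | omega | tauto

/-- Some pair of `r` is separated by `X`. -/
def SplitsRel (r : V → V → Prop) (X : Set V) : Prop := ∃ a b, r a b ∧ a ∈ X ∧ b ∉ X

theorem SplitsRel.compl {r : V → V → Prop} (hr : ∀ a b, r a b → r b a) {X : Set V}
    (h : SplitsRel r X) : SplitsRel r Xᶜ := by
  obtain ⟨a, b, hab, ha, hb⟩ := h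
  exact ⟨b, a, hr _ _ hab, hb, by simpa using ha⟩

theorem SplitsRel.uncross {r : V → V → Prop} (hr : ∀ a b, r a b → r b a) {X Y : Set V}
    (hX : SplitsRel r X) (hY : SplitsRel r Y) :
    (SplitsRel r (X ∩ Y) ∧ SplitsRel r (X ∪ Y)) ∨ (SplitsRel r (X \ Y) ∧ SplitsRel r (Y \ X)) := by
  obtain ⟨a, b, hab, ha, hb⟩ := hX
  obtain ⟨c, d, hcd, hc, hd⟩ := hY
  have key : ∀ Z : Set V, (a ∈ Z ∧ b ∉ Z) ∨ (b ∈ Z ∧ a ∉ Z) ∨ (c ∈ Z ∧ d ∉ Z) ∨ (d ∈ Z ∧ c ∉ Z) →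
      SplitsRel r Z := by
    rintro Z (⟨h, h'⟩ | ⟨h, h'⟩ | ⟨h, h'⟩ | ⟨h, h'⟩)
    exacts [⟨a, b, hab, h, h'⟩, ⟨b, a, hr _ _ hab, h, h'⟩, ⟨c, d, hcd, h, h'⟩, ⟨d, c, hr _ _ hcd, h, h'⟩]
  have k1 := key (X ∩ Y)
  have k2 := key (X ∪ Y)
  have k3 := key (X \ Y)
  have k4 := key (Y \ X)
  simp only [Set.mem_inter_iff, Set.mem_union, Set.mem_sdiff] at k1 k2 k3 k4
  by_cases h1 : a ∈ Y <;> by_cases h2 : b ∈ Y <;> by_cases h3 : c ∈ X <;> by_cases h4 : d ∈ X <;>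
    simp only [ha, hb, hc, hd, h1, h2, h3, h4, and_true, not_true, not_false_eq_true, or_true,
      and_false, or_false, or_self, and_self, forall_const] at k1 k2 k3 k4 ⊢ <;> tauto

/-- The vertex `x` lies in a pair of `r` with two different entries. -/
def Heavy (r : V → V → Prop) (x : V) : Prop := ∃ y, r x y ∧ y ≠ x

variable [Finite V]

/-- Splitting off a pair of edges at a vertex outside the terminal set of an Eulerian multigraph
can be done so that all cuts separating a terminal pair keep size at least `k`. -/
theorem exists_splitting_off {r : V → V → Prop} (hr : ∀ a b, r a b → r b a) {k : ℕ} (hk : Even k)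
    {E : Multiset (Sym2 V)} {x t : V} (hE : ∀ X, Even (cutSize (s(x, t) ::ₘ E) X))
    (hcut : ∀ X, SplitsRel r X → k ≤ cutSize (s(x, t) ::ₘ E) X) (hx : ¬ Heavy r x) (ht : t ≠ x) :
    ∃ y E', E = s(x, y) ::ₘ E' ∧ ∀ X, SplitsRel r X → k ≤ cutSize (s(t, y) ::ₘ E') X := by
  by_contra! hcon
  -- Splitting off `xt`, `xy` lowers a cut only if it separates `x` from both `t` and `y`, and then
  -- by exactly 2. By parity, a cut that falls below `k` had exactly `k` edges.
  have tight : ∀ y, s(x, y) ∈ E → ∃ X, x ∉ X ∧ t ∈ X ∧ y ∈ X ∧ SplitsRel r X ∧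
      cutSize (s(x, t) ::ₘ E) X ≤ k := by
    intro y hy
    obtain ⟨E', hE'⟩ := Multiset.exists_cons_of_mem hy
    obtain ⟨X, hX, hlt⟩ := hcon y E' hE'
    have main : ∀ X, x ∉ X → SplitsRel r X → cutSize (s(t, y) ::ₘ E') X < k →
        ∃ X, x ∉ X ∧ t ∈ X ∧ y ∈ X ∧ SplitsRel r X ∧ cutSize (s(x, t) ::ₘ E) X ≤ k := by
      intro X hxX hX hlt
      have h1 := hcut X hX
      have h2 := hE X
      subst hE'
      simp only [cutSize_cons, splitBy_mk, hxX, false_iff, not_not] at h1 h2 hlt ⊢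
      by_cases htX : t ∈ X <;> by_cases hyX : y ∈ X
      · refine ⟨X, hxX, htX, hyX, hX, ?_⟩
        simp only [hxX, htX, hyX, iff_true, not_true, not_false_eq_true, if_false, if_true]
          at h1 h2 hlt ⊢
        obtain ⟨a, rfl⟩ := hk
        obtain ⟨b, hb⟩ := h2
        omega
      all_goals
        exfalso
        simp [htX, hyX] at h1 hlt
        omega
    by_cases hxX : x ∈ X
    · exact main Xᶜ (by simpa using hxX) (hX.compl hr) (by rwa [cutSize_compl])
    · exact main X hxX hX hlt
  -- The degree of `x` is even, so `xt` is not the only non-loop edge at `x`.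
  have hodd : ∃ y, s(x, y) ∈ E ∧ y ≠ x := by
    have h := hE {x}
    rw [cutSize_cons, if_pos (by simp [ht])] at h
    have hpos : 0 < cutSize E {x} := by
      rcases Nat.eq_zero_or_pos (cutSize E {x}) with h0 | h0
      · rw [h0] at h; exact absurd h (by decide)
      · exact h0
    obtain ⟨e, he, a, b, rfl, ha, hb⟩ := Multiset.countP_pos.1 hpos
    rw [Set.mem_singleton_iff] at ha
    subst ha
    exact ⟨b, he, by simpa using hb⟩
  obtain ⟨y₀, hy₀, -⟩ := hodd
  obtain ⟨X₀, hX₀⟩ := tight y₀ hy₀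
  obtain ⟨X, -, hXmax⟩ := Finite.exists_le_maximal
    (p := fun X : Set V => x ∉ X ∧ t ∈ X ∧ SplitsRel r X ∧ cutSize (s(x, t) ::ₘ E) X ≤ k)
    ⟨hX₀.1, hX₀.2.1, hX₀.2.2.2⟩
  obtain ⟨hxX, htX, hXr, hXk⟩ := hXmax.prop
  -- Otherwise adding `x` to `X` would lose the edge `xt` and gain none, giving a cut below `k`; it
  -- still splits `r` because `x` is not a terminal.
  have hnbr : ∃ y, s(x, y) ∈ E ∧ y ≠ x ∧ y ∉ X := by
    by_contra! hall
    have hle : cutSize E (insert x X) ≤ cutSize E X := by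
      refine countP_le_countP fun e he hs => ?_
      obtain ⟨a, b, rfl, ha, hb⟩ := hs
      rw [Set.mem_insert_iff, not_or] at hb
      rcases Set.mem_insert_iff.1 ha with rfl | ha
      · exact absurd (hall b he hb.1) hb.2
      · exact ⟨a, b, rfl, ha, hb.2⟩
    have hspl : SplitsRel r (insert x X) := by
      obtain ⟨a, b, hab, ha, hb⟩ := hXr
      refine ⟨a, b, hab, Set.mem_insert_of_mem _ ha, ?_⟩
      rw [Set.mem_insert_iff, not_or]
      refine ⟨?_, hb⟩
      rintro rfl
      exact hx ⟨a, hr _ _ hab, fun h => hxX (h ▸ ha)⟩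
    have h1 := hcut _ hspl
    rw [cutSize_cons, if_neg (by simp [htX])] at h1
    rw [cutSize_cons, if_pos (by simp [hxX, htX])] at hXk
    omega
  obtain ⟨y, hyE, hyx, hyX⟩ := hnbr
  obtain ⟨Y, hxY, htY, hyY, hYr, hYk⟩ := tight y hyE
  -- Intersection and union: the union is tight as well, against maximality of `X`. Differences:
  -- `xt` crosses both `X` and `Y` but neither difference, so the two differences cannot both have
  -- `k` edges.
  rcases hXr.uncross hr hYr with ⟨h1, h2⟩ | ⟨h1, h2⟩
  · have h3 := cutSize_inter_add_union_le (s(x, t) ::ₘ E) X Y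
    have h4 := hcut _ h1
    have h5 := hXmax.le_of_ge (y := X ∪ Y)
      ⟨by simp [hxX, hxY], Or.inl htX, h2, by omega⟩ Set.subset_union_left
    exact hyX (h5 (Or.inr hyY))
  · have h3 := cutSize_diff_add_diff_le E X Y
    have h4 := hcut _ h1
    have h5 := hcut _ h2
    rw [cutSize_cons, if_neg (by simp [htX, htY, hxX])] at h4
    rw [cutSize_cons, if_neg (by simp [htX, htY, hxY])] at h5
    rw [cutSize_cons, if_pos (by simp [hxX, htX])] at hXk
    rw [cutSize_cons, if_pos (by simp [hxY, htY])] at hYk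
    omega

/-- All edges that are not loops can be moved to the terminals. -/
theorem exists_split_off_all {r : V → V → Prop} (hr : ∀ a b, r a b → r b a) {k : ℕ} (hk : Even k)
    (E : Multiset (Sym2 V)) (hE : ∀ X, Even (cutSize E X))
    (hcut : ∀ X, SplitsRel r X → k ≤ cutSize E X) :
    ∃ E' : Multiset (Sym2 V), (∀ X, Even (cutSize E' X)) ∧
      (∀ X, SplitsRel r X → k ≤ cutSize E' X) ∧ (∀ X, cutSize E' X ≤ cutSize E X) ∧
      ∀ a b, s(a, b) ∈ E' → a ≠ b ∧ Heavy r a := by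
  induction hn : E.card using Nat.strong_induction_on generalizing E with
  | h n ih =>
  by_cases hall : ∀ a b, s(a, b) ∈ E → a ≠ b ∧ Heavy r a
  · exact ⟨E, hE, hcut, fun _ => le_rfl, hall⟩
  push Not at hall
  obtain ⟨x, t, hmem, hxt⟩ := hall
  obtain ⟨E₁, rfl⟩ := Multiset.exists_cons_of_mem hmem
  by_cases hne : x = t
  · subst hne
    have hsame : ∀ X, cutSize (s(x, x) ::ₘ E₁) X = cutSize E₁ X := fun X => by
      rw [cutSize_cons, if_neg (by simp), add_zero]
    simp only [hsame] at hE hcut ⊢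
    exact ih E₁.card (by simp [← hn]) E₁ hE hcut rfl
  · obtain ⟨y, E₂, rfl, hcut'⟩ := exists_splitting_off hr hk hE hcut (hxt hne) (Ne.symm hne)
    -- Splitting off changes each cut by 0 or 2, so it preserves parity and never increases a cut.
    have hrel : ∀ X, ∃ j, cutSize (s(x, t) ::ₘ s(x, y) ::ₘ E₂) X =
        cutSize (s(t, y) ::ₘ E₂) X + 2 * j := by
      intro X
      simp only [cutSize_cons, splitBy_mk]
      by_cases h1 : x ∈ X <;> by_cases h2 : t ∈ X <;> by_cases h3 : y ∈ X <;>
        simp [h1, h2, h3] <;> first | exact ⟨0, rfl⟩ | exact ⟨1, by omega⟩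
    have hE' : ∀ X, Even (cutSize (s(t, y) ::ₘ E₂) X) := fun X => by
      obtain ⟨j, hj⟩ := hrel X
      have := hE X
      rw [hj] at this
      simpa [Nat.even_add] using this
    obtain ⟨E', h1, h2, h3, h4⟩ := ih (s(t, y) ::ₘ E₂).card (by simp [← hn]) _ hE' hcut' rfl
    refine ⟨E', h1, h2, fun X => (h3 X).trans ?_, h4⟩
    obtain ⟨j, hj⟩ := hrel X
    omega

end CutCounting

end CutSparsifier

/-! ### Counting cuts by contraction -/

namespace CutSparsifier

section CutCounting

open Classical

variable {V : Type*} [Fintype V]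

theorem sum_cutSize_singleton {E : Multiset (Sym2 V)} (hE : ∀ a b, s(a, b) ∈ E → a ≠ b) :
    ∑ x, cutSize E {x} = 2 * E.card := by
  induction E using Multiset.induction with
  | empty => simp [cutSize]
  | cons e E ih =>
    simp only [cutSize_cons, Finset.sum_add_distrib, Multiset.card_cons]
    rw [ih fun a b h => hE a b (Multiset.mem_cons_of_mem h)]
    induction e with
    | h a b =>
      have hab := hE a b (Multiset.mem_cons_self _ _)
      have : ∀ x, (if SplitBy {x} s(a, b) then 1 else 0) =
          (if a = x then 1 else 0) + if b = x then 1 else 0 := by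
        intro x
        simp only [splitBy_mk, Set.mem_singleton_iff]
        by_cases h1 : a = x <;> by_cases h2 : b = x <;> simp [h1, h2]
        exact hab (h1.trans h2.symm)
      simp only [this, Finset.sum_add_distrib, Finset.sum_ite_eq, Finset.mem_univ, if_true]
      ring

/-- The singleton of a terminal splits `r`, so every terminal has degree at least `k`; then sum the
degrees. -/
theorem card_heavy_mul_le {r : V → V → Prop} {k : ℕ} {E : Multiset (Sym2 V)}
    (hcut : ∀ X, SplitsRel r X → k ≤ cutSize E X) (hE : ∀ a b, s(a, b) ∈ E → a ≠ b) :
    (Finset.univ.filter (Heavy r)).card * k ≤ 2 * E.card := by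
  rw [← sum_cutSize_singleton hE, ← smul_eq_mul]
  refine (Finset.card_nsmul_le_sum _ (fun x => cutSize E {x}) k fun x hx => hcut _ ?_).trans
    (Finset.sum_le_sum_of_subset (Finset.subset_univ _))
  obtain ⟨y, hxy, hne⟩ := (Finset.mem_filter.1 hx).2
  exact ⟨x, y, hxy, rfl, hne⟩

omit [Fintype V] in
-- Double counting of pairs `(X, e)`, according to whether `X` separates `e`. This is the averaged
-- form of contracting a random edge: `B` bounds the cuts that survive the contraction of `e`.
theorem card_mul_le_of_contract {E : Multiset (Sym2 V)} {S : Finset (Set V)} {c B : ℕ}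
    (hc : ∀ X ∈ S, cutSize E X ≤ c) (hB : ∀ e ∈ E, (S.filter fun X => ¬ SplitBy X e).card ≤ B) :
    S.card * E.card ≤ S.card * c + E.card * B := by
  have h1 : S.card * E.card ≤ ∑ X ∈ S, cutSize E X + E.card * B := by
    clear hc
    induction E using Multiset.induction with
    | empty => simp
    | cons e E ih =>
      have h2 := ih fun e' he' => hB e' (Multiset.mem_cons_of_mem he')
      have h3 := hB e (Multiset.mem_cons_self _ _)
      have h4 := Finset.card_filter_add_card_filter_not (s := S) (fun X => SplitBy X e)
      simp only [cutSize_cons, Finset.sum_add_distrib, Multiset.card_cons, ← Finset.card_filter]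
      nlinarith
  have h2 : ∑ X ∈ S, cutSize E X ≤ S.card * c := by
    simpa using Finset.sum_le_card_nsmul S _ c hc
  omega

/-- Two cuts with the same trace separate the same pairs of `r`. -/
def SameTrace (r : V → V → Prop) (X Y : Set V) : Prop :=
  ∀ a b, r a b → ((a ∈ X ↔ b ∈ X) ↔ (a ∈ Y ↔ b ∈ Y))

theorem card_le_two_pow_card_heavy {r : V → V → Prop} (hr : ∀ a b, r a b → r b a)
    {S : Finset (Set V)} (hS : ∀ X ∈ S, ∀ Y ∈ S, SameTrace r X Y → X = Y) :
    S.card ≤ 2 ^ (Finset.univ.filter (Heavy r)).card := by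
  rw [← Finset.card_powerset]
  refine Finset.card_le_card_of_injOn (fun X => (Finset.univ.filter (Heavy r)).filter (· ∈ X))
    (fun X _ => Finset.mem_powerset.2 (Finset.filter_subset _ _)) fun X hX Y hY hXY => ?_
  refine hS X hX Y hY fun a b hab => ?_
  by_cases hne : a = b
  · subst hne; simp
  have key : ∀ x, Heavy r x → (x ∈ X ↔ x ∈ Y) := fun x hx => by
    have := congrArg (x ∈ ·) hXY
    simpa [hx] using this
  rw [key a ⟨b, hab, Ne.symm hne⟩, key b ⟨a, hr _ _ hab, hne⟩]

/-- **Counting small cuts.**  If every cut that separates a pair of `r` has at least `2 * K`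
edges, then the cuts with at most `m * K` edges have few different traces on the pairs of `r`. -/
theorem card_small_cuts_le (m K : ℕ) (hK : 0 < K) (h : ℕ) :
    ∀ (r : V → V → Prop) (E : Multiset (Sym2 V)) (S : Finset (Set V)),
      (∀ a b, r a b → r b a) → (∀ X, Even (cutSize E X)) →
      (∀ X, SplitsRel r X → 2 * K ≤ cutSize E X) →
      (Finset.univ.filter (Heavy r)).card ≤ h →
      (∀ X ∈ S, cutSize E X ≤ m * K) → (∀ X ∈ S, ∀ Y ∈ S, SameTrace r X Y → X = Y) →
      S.card ≤ 2 ^ m * (max h m).choose m := by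
  induction h with
  | zero =>
    intro r E S hr hE hcut hh hm hS
    refine (card_le_two_pow_card_heavy hr hS).trans ?_
    rw [Nat.le_zero.1 hh]
    simpa using Nat.one_le_two_pow
  | succ h ih =>
    intro r E₀ S hr hE₀ hcut₀ hh hm₀ hS
    rcases Nat.lt_or_ge m (h + 1) with hmh | hmh
    swap
    · rw [max_eq_right hmh, Nat.choose_self, mul_one]
      exact (card_le_two_pow_card_heavy hr hS).trans
        (Nat.pow_le_pow_right (by norm_num) (hh.trans hmh))
    rcases Nat.lt_or_ge (Finset.univ.filter (Heavy r)).card (h + 1) with hlt | hge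
    · refine (ih r E₀ S hr hE₀ hcut₀ (by omega) hm₀ hS).trans ?_
      gcongr
      omega
    -- After splitting off, all edges join distinct terminals. The degree count gives at least `(h +
    -- 1) * K` of them, and contracting any one destroys a terminal.
    obtain ⟨E, hE, hcut, hle, hnl⟩ := exists_split_off_all hr (even_two_mul K) E₀ hE₀ hcut₀
    have hm : ∀ X ∈ S, cutSize E X ≤ m * K := fun X hX => (hle X).trans (hm₀ X hX)
    have hW : (h + 1) * K ≤ E.card := by
      have := card_heavy_mul_le hcut fun a b hab => (hnl a b hab).1
      nlinarith
    have hB : ∀ e ∈ E, (S.filter fun X => ¬ SplitBy X e).card ≤ 2 ^ m * h.choose m := by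
      intro e he
      induction e with
      | h a b =>
      obtain ⟨hab, ha⟩ := hnl a b he
      have hb : Heavy r b := (hnl b a (Sym2.eq_swap ▸ he)).2
      -- Contraction of `ab` as a map of the vertices. Cuts not separating `a` from `b` are their
      -- own preimages, so they keep their sizes and traces.
      let φ : V → V := fun x => if x = b then a else x
      have hφ : ∀ X : Set V, cutSize (E.map (Sym2.map φ)) X = cutSize E (φ ⁻¹' X) := fun X => by
        rw [cutSize, Multiset.countP_map, ← Multiset.countP_eq_card_filter]
        unfold cutSize
        congr 1
        funext e
        induction e with
        | h c d => simp
      have hφX : ∀ X : Set V, ¬ SplitBy X s(a, b) → φ ⁻¹' X = X := fun X hX => by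
        rw [splitBy_mk, not_not] at hX
        ext x
        by_cases hx : x = b
        · subst hx; simp [φ, hX]
        · simp [φ, hx]
      let r' : V → V → Prop := fun x y => ∃ c d, r c d ∧ φ c = x ∧ φ d = y
      have hspl : ∀ X, SplitsRel r' X → SplitsRel r (φ ⁻¹' X) := by
        rintro X ⟨x, y, ⟨c, d, hcd, rfl, rfl⟩, h1, h2⟩
        exact ⟨c, d, hcd, h1, h2⟩
      have := ih r' (E.map (Sym2.map φ)) (S.filter fun X => ¬ SplitBy X s(a, b))
        (by rintro _ _ ⟨c, d, hcd, rfl, rfl⟩; exact ⟨d, c, hr _ _ hcd, rfl, rfl⟩)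
        (fun X => by rw [hφ]; exact hE _)
        (fun X hX => by rw [hφ]; exact hcut _ (hspl X hX)) ?_ ?_ ?_
      · rwa [max_eq_left (by omega)] at this
      · have hsub : Finset.univ.filter (Heavy r') ⊆ (Finset.univ.filter (Heavy r)).erase b := by
          intro x hx
          obtain ⟨y, ⟨c, d, hcd, rfl, rfl⟩, hne⟩ := (Finset.mem_filter.1 hx).2
          have hcd' : d ≠ c := fun h => hne (by rw [h])
          rw [Finset.mem_erase, Finset.mem_filter]
          by_cases hc : c = b
          · simp [φ, hc, hab, ha]
          · simp only [φ, hc, if_false, ne_eq, not_false_eq_true, Finset.mem_univ, true_and]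
            exact ⟨d, hcd, hcd'⟩
        have h1 := Finset.card_le_card hsub
        rw [Finset.card_erase_of_mem (by simpa using hb)] at h1
        omega
      · intro X hX
        rw [Finset.mem_filter] at hX
        rw [hφ, hφX X hX.2]
        exact hm X hX.1
      · intro X hX Y hY hXY
        rw [Finset.mem_filter] at hX hY
        refine hS X hX.1 Y hY.1 fun c d hcd => ?_
        have := hXY (φ c) (φ d) ⟨c, d, hcd, rfl, rfl⟩
        simp only [← Set.mem_preimage, hφX X hX.2, hφX Y hY.2] at this
        exact this
    -- With `|E| ≥ (h + 1) K` this reads `|S| (1 - m / (h + 1)) ≤ 2 ^ m * h.choose m`, and `(h + 1 -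
    -- m) * (h + 1).choose m = (h + 1) * h.choose m` closes the recursion.
    have hmain := card_mul_le_of_contract hm hB
    have hchoose := Nat.choose_mul_succ_eq h m
    rw [max_eq_left (by omega)]
    obtain ⟨j, hj⟩ : ∃ j, h + 1 = m + j + 1 := ⟨h - m, by omega⟩
    rw [show h + 1 - m = j + 1 by omega] at hchoose
    have hWpos : 0 < E.card := lt_of_lt_of_le (by positivity) hW
    refine Nat.le_of_mul_le_mul_right ?_ (show 0 < (j + 1) * E.card by positivity)
    have h2 : S.card * (m * K) * (h + 1) ≤ S.card * m * E.card := by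
      calc S.card * (m * K) * (h + 1) = S.card * m * ((h + 1) * K) := by ring
        _ ≤ _ := Nat.mul_le_mul_left _ hW
    have h3 : S.card * E.card * (h + 1) ≤
        S.card * m * E.card + 2 ^ m * (h.choose m * (h + 1)) * E.card := by
      calc _ ≤ (S.card * (m * K) + E.card * (2 ^ m * h.choose m)) * (h + 1) :=
            Nat.mul_le_mul_right _ hmain
        _ ≤ _ := by linarith
    rw [hchoose, hj] at h3
    rw [hj]
    linarith

theorem card_small_cuts_le_pow {m K : ℕ} (hK : 0 < K) {r : V → V → Prop}
    {E : Multiset (Sym2 V)} {S : Finset (Set V)} (hr : ∀ a b, r a b → r b a)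
    (hE : ∀ X, Even (cutSize E X)) (hcut : ∀ X, SplitsRel r X → 2 * K ≤ cutSize E X)
    (hm : ∀ X ∈ S, cutSize E X ≤ m * K) (hS : ∀ X ∈ S, ∀ Y ∈ S, SameTrace r X Y → X = Y)
    (hV : 0 < Fintype.card V) : S.card ≤ (2 * Fintype.card V) ^ m := by
  refine (card_small_cuts_le m K hK (Fintype.card V) r E S hr hE hcut
    (Finset.card_le_univ _) hm hS).trans ?_
  rw [mul_pow]
  refine Nat.mul_le_mul_left _ ?_
  rcases le_total (Fintype.card V) m with h | h
  · rw [max_eq_right h, Nat.choose_self]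
    exact Nat.one_le_pow _ _ hV
  · rw [max_eq_left h]
    exact Nat.choose_le_pow _ _

end CutCounting

/-! ### Maximum flows and minimum cuts -/

section MaxFlow

open Classical

variable {α β : Type*} {G : Graph α β}

theorem crosses_iff {S : Set V(G)} {e : E(G)} {a b : V(G)} (h : G.IsLink e a b) :
    Crosses G S e ↔ ¬ (a ∈ S ↔ b ∈ S) := by
  constructor
  · rintro ⟨c, d, h', hc, hd⟩
    rcases h.eq_and_eq_or_eq_and_eq h' with ⟨h1, h2⟩ | ⟨h1, h2⟩
    · rw [Subtype.ext h1, Subtype.ext h2]; tauto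
    · rw [Subtype.ext h1, Subtype.ext h2]; tauto
  · intro hn
    by_cases ha : a ∈ S
    · exact ⟨a, b, h, ha, by tauto⟩
    · exact ⟨b, a, h.symm, by tauto, ha⟩

theorem exists_isLink (e : E(G)) : ∃ a b : V(G), G.IsLink e a b := by
  obtain ⟨x, y, h⟩ := Graph.exists_isLink_of_mem_edgeSet e.2
  exact ⟨⟨x, h.left_mem⟩, ⟨y, h.right_mem⟩, h⟩

theorem crosses_compl {S : Set V(G)} {e : E(G)} : Crosses G Sᶜ e ↔ Crosses G S e := by
  obtain ⟨a, b, h⟩ := exists_isLink e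
  simp only [crosses_iff h, Set.mem_compl_iff]
  tauto

variable [Fintype E(G)]

/-- The set of edges of `G` crossing the cut `S`. -/
noncomputable def cutEdges (G : Graph α β) [Fintype E(G)] (S : Set V(G)) : Finset E(G) :=
  Finset.univ.filter (Crosses G S)

@[simp]
theorem mem_cutEdges {S : Set V(G)} {e : E(G)} : e ∈ cutEdges G S ↔ Crosses G S e := by
  simp [cutEdges]

theorem cutEdges_compl (S : Set V(G)) : cutEdges G Sᶜ = cutEdges G S := by
  ext e; simp [crosses_compl]

variable [Fintype V(G)] {s t : V(G)} {f : E(G) → V(G) → V(G) → ℝ}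

theorem sum_sum_eq_zero_of_antisymm {ι : Type*} (A : Finset ι) {g : ι → ι → ℝ}
    (hg : ∀ u v, g u v = -g v u) : ∑ u ∈ A, ∑ v ∈ A, g u v = 0 := by
  have h : ∑ u ∈ A, ∑ v ∈ A, g u v = -∑ u ∈ A, ∑ v ∈ A, g u v := by
    conv_lhs => rw [Finset.sum_comm]
    simp only [← Finset.sum_neg_distrib]
    exact Finset.sum_congr rfl fun u _ => Finset.sum_congr rfl fun v _ => hg _ _
  linarith

/-- Conservation allows summing the net outflow over all of `S`; the flow inside `S` cancels by
antisymmetry. -/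
theorem IsFlow.flowValue_eq (hf : IsFlow G s t f) {S : Set V(G)} (hs : s ∈ S) (ht : t ∉ S) :
    flowValue G s f = ∑ e, ∑ u with u ∈ S, ∑ v with v ∉ S, f e u v := by
  have h1 : flowValue G s f = ∑ u with u ∈ S, ∑ e, ∑ v, f e u v := by
    rw [Finset.sum_eq_single_of_mem s (by simpa using hs)]
    · rfl
    · intro u hu hne
      refine hf.conservation u hne ?_
      rintro rfl
      exact ht (Finset.mem_filter.1 hu).2
  rw [h1, Finset.sum_comm]
  refine Finset.sum_congr rfl fun e _ => ?_
  have h2 := sum_sum_eq_zero_of_antisymm (Finset.univ.filter (· ∈ S)) (hf.antisymm e)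
  have h3 : ∀ u, ∑ v, f e u v = ∑ v with v ∈ S, f e u v + ∑ v with v ∉ S, f e u v := fun u =>
    (Finset.sum_filter_add_sum_filter_not _ _ _).symm
  simp only [h3, Finset.sum_add_distrib, h2, zero_add]

theorem IsFlow.sum_edge_eq (hf : IsFlow G s t f) {S : Set V(G)} {e : E(G)} {a b : V(G)}
    (h : G.IsLink e a b) (ha : a ∈ S) (hb : b ∉ S) :
    ∑ u with u ∈ S, ∑ v with v ∉ S, f e u v = f e a b := by
  have key : ∀ u v : V(G), u ∈ S → ¬ (u = a ∧ v = b) → f e u v = 0 := by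
    intro u v hu hne
    refine hf.support e u v fun h' => ?_
    rcases h'.eq_and_eq_or_eq_and_eq h with ⟨h1, h2⟩ | ⟨h1, h2⟩
    · exact hne ⟨Subtype.ext h1, Subtype.ext h2⟩
    · exact hb (Subtype.ext h1 ▸ hu)
  rw [Finset.sum_eq_single_of_mem a (by simpa using ha),
    Finset.sum_eq_single_of_mem b (by simpa using hb)]
  · exact fun v _ hv => key a v ha fun h => hv h.2
  · exact fun u hu hua => Finset.sum_eq_zero fun v _ =>
      key u v (Finset.mem_filter.1 hu).2 fun h => hua h.1

theorem IsFlow.sum_edge_eq_zero (hf : IsFlow G s t f) {S : Set V(G)} {e : E(G)}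
    (h : ¬ Crosses G S e) : ∑ u with u ∈ S, ∑ v with v ∉ S, f e u v = 0 :=
  Finset.sum_eq_zero fun u hu => Finset.sum_eq_zero fun v hv => hf.support e u v fun h' =>
    h ⟨u, v, h', (Finset.mem_filter.1 hu).2, (Finset.mem_filter.1 hv).2⟩

theorem IsFlow.flowValue_le (hf : IsFlow G s t f) {S : Set V(G)} (hs : s ∈ S) (ht : t ∉ S) :
    flowValue G s f ≤ (cutEdges G S).card := by
  rw [hf.flowValue_eq hs ht, cutEdges, Finset.card_filter, Nat.cast_sum]
  refine Finset.sum_le_sum fun e _ => ?_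
  by_cases h : Crosses G S e
  · obtain ⟨a, b, hab, ha, hb⟩ := id h
    rw [hf.sum_edge_eq hab ha hb, if_pos h]
    exact_mod_cast hf.capacity e a b
  · rw [hf.sum_edge_eq_zero h, if_neg h, Nat.cast_zero]

theorem IsFlow.flowValue_eq_of_saturated (hf : IsFlow G s t f) {S : Set V(G)} (hs : s ∈ S)
    (ht : t ∉ S) (hsat : ∀ (e : E(G)) (a b : V(G)), G.IsLink e a b → a ∈ S → b ∉ S → f e a b = 1) :
    flowValue G s f = (cutEdges G S).card := by
  rw [hf.flowValue_eq hs ht, cutEdges, Finset.card_filter, Nat.cast_sum]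
  refine Finset.sum_congr rfl fun e _ => ?_
  by_cases h : Crosses G S e
  · obtain ⟨a, b, hab, ha, hb⟩ := id h
    rw [hf.sum_edge_eq hab ha hb, if_pos h, hsat e a b hab ha hb, Nat.cast_one]
  · rw [hf.sum_edge_eq_zero h, if_neg h, Nat.cast_zero]

/-- The edge `e` can carry more flow from `u` to `v`. -/
def Residual (G : Graph α β) (f : E(G) → V(G) → V(G) → ℝ) (u v : V(G)) : Prop :=
  ∃ e : E(G), G.IsLink e u v ∧ f e u v < 1

/-- A flow of value one from `s` to `u`, without capacity constraints, along residual arcs. -/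
structure IsAugmentation (G : Graph α β) [Fintype V(G)] [Fintype E(G)]
    (f : E(G) → V(G) → V(G) → ℝ) (s u : V(G)) (g : E(G) → V(G) → V(G) → ℝ) : Prop where
  antisymm : ∀ (e : E(G)) (u v : V(G)), g e u v = -g e v u
  support : ∀ (e : E(G)) (u v : V(G)), ¬ G.IsLink e u v → g e u v = 0
  residual : ∀ (e : E(G)) (u v : V(G)), 0 < g e u v → f e u v < 1
  net : ∀ x : V(G), ∑ e, ∑ v, g e x v = (if x = s then 1 else 0) - if x = u then 1 else 0

/-- One unit is sent along each arc of a residual walk. The walk may repeat arcs, which is harmless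
because the result is later scaled by a small factor. -/
theorem exists_isAugmentation {u : V(G)} (h : Relation.ReflTransGen (Residual G f) s u) :
    ∃ g, IsAugmentation G f s u g := by
  induction h with
  | refl => exact ⟨fun _ _ _ => 0, by simp, by simp, by simp, by simp⟩
  | @tail a b _ hab ih =>
    obtain ⟨g, hg⟩ := ih
    obtain ⟨e₀, hl, hlt⟩ := hab
    refine ⟨fun e x y => g e x y + ((if e = e₀ ∧ x = a ∧ y = b then 1 else 0) -
      if e = e₀ ∧ x = b ∧ y = a then 1 else 0), ?_, ?_, ?_, ?_⟩
    · intro e x y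
      simp only [hg.antisymm e x y, and_comm (a := x = a), and_comm (a := x = b)]
      ring
    · intro e x y hn
      rw [hg.support e x y hn, if_neg, if_neg]
      · simp
      · rintro ⟨rfl, rfl, rfl⟩; exact hn hl.symm
      · rintro ⟨rfl, rfl, rfl⟩; exact hn hl
    · intro e x y hpos
      by_cases h1 : e = e₀ ∧ x = a ∧ y = b
      · obtain ⟨rfl, rfl, rfl⟩ := h1; exact hlt
      · rw [if_neg h1] at hpos
        refine hg.residual e x y ?_
        split_ifs at hpos <;> linarith
    · intro x
      have h1 : ∀ c d : V(G), ∑ e : E(G), ∑ y, (if e = e₀ ∧ x = c ∧ y = d then (1 : ℝ) else 0) =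
          if x = c then 1 else 0 := by
        intro c d
        rw [Finset.sum_eq_single e₀ (by intro e _ he; simp [he]) (by simp),
          Finset.sum_eq_single d (by intro y _ hy; simp [hy]) (by simp)]
        simp
      simp only [Finset.sum_add_distrib, Finset.sum_sub_distrib, hg.net, h1]
      ring

/-- The feasible flows form a closed subset of a compact box, and the value is continuous. -/
theorem exists_max_flow (s t : V(G)) :
    ∃ f, IsFlow G s t f ∧ ∀ f', IsFlow G s t f' → flowValue G s f' ≤ flowValue G s f := by
  have hclosed : IsClosed {f | IsFlow G s t f} := by
    have : {f | IsFlow G s t f} = {f | (∀ (e : E(G)) (u v : V(G)), f e u v = -f e v u) ∧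
        (∀ (e : E(G)) (u v : V(G)), ¬ G.IsLink e u v → f e u v = 0) ∧
        (∀ (e : E(G)) (u v : V(G)), f e u v ≤ 1) ∧
        (∀ u : V(G), u ≠ s → u ≠ t → ∑ e, ∑ v, f e u v = 0)} := by
      ext f
      exact ⟨fun h => ⟨h.1, h.2, h.3, h.4⟩, fun h => ⟨h.1, h.2.1, h.2.2.1, h.2.2.2⟩⟩
    rw [this]
    simp only [Set.ofPred_and, Set.ofPred_forall]
    refine IsClosed.inter ?_ (IsClosed.inter ?_ (IsClosed.inter ?_ ?_))
    · exact isClosed_iInter fun e => isClosed_iInter fun u => isClosed_iInter fun v =>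
        isClosed_eq (by fun_prop) (by fun_prop)
    · exact isClosed_iInter fun e => isClosed_iInter fun u => isClosed_iInter fun v =>
        isClosed_iInter fun _ => isClosed_eq (by fun_prop) (by fun_prop)
    · exact isClosed_iInter fun e => isClosed_iInter fun u => isClosed_iInter fun v =>
        isClosed_le (by fun_prop) (by fun_prop)
    · exact isClosed_iInter fun u => isClosed_iInter fun _ => isClosed_iInter fun _ =>
        isClosed_eq (by fun_prop) (by fun_prop)
  have hcompact : IsCompact {f | IsFlow G s t f} := by
    refine (isCompact_Icc (a := fun _ _ _ => (-1 : ℝ)) (b := fun _ _ _ => (1 : ℝ))).of_isClosed_subset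
      hclosed fun f hf => ⟨fun e u v => ?_, fun e u v => hf.capacity e u v⟩
    have h1 := hf.antisymm e u v
    have h2 := hf.capacity e v u
    change -1 ≤ f e u v
    linarith
  obtain ⟨f, hf, hmax⟩ := hcompact.exists_isMaxOn (f := flowValue G s)
    ⟨fun _ _ _ => 0, by simp, by simp, by simp, by simp⟩
    (by unfold flowValue; fun_prop)
  exact ⟨f, hf, fun f' hf' => hmax hf'⟩

theorem IsFlow.not_reachable_of_max (hf : IsFlow G s t f) (hst : s ≠ t)
    (hmax : ∀ f', IsFlow G s t f' → flowValue G s f' ≤ flowValue G s f) :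
    ¬ Relation.ReflTransGen (Residual G f) s t := by
  intro h
  obtain ⟨g, hg⟩ := exists_isAugmentation h
  -- Each of the finitely many capacity constraints holds for all small `δ > 0`: it either has
  -- slack, or `g` does not increase that flow.
  have hδ : ∃ δ > 0, ∀ (e : E(G)) (u v : V(G)), f e u v + δ * g e u v ≤ 1 := by
    have hev : ∀ᶠ δ in nhdsWithin (0 : ℝ) (Set.Ioi 0), ∀ (e : E(G)) (u v : V(G)),
        f e u v + δ * g e u v ≤ 1 := by
      simp only [Filter.eventually_all]
      intro e u v
      rcases le_or_gt (g e u v) 0 with h0 | h0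
      · filter_upwards [self_mem_nhdsWithin] with δ hδ
        have := hf.capacity e u v
        have : δ * g e u v ≤ 0 := mul_nonpos_of_nonneg_of_nonpos (le_of_lt hδ) h0
        linarith
      · have hcont : Filter.Tendsto (fun δ : ℝ => f e u v + δ * g e u v) (nhds 0)
            (nhds (f e u v + 0 * g e u v)) := Continuous.tendsto (by fun_prop) 0
        have hlt : f e u v + 0 * g e u v < 1 := by simpa using hg.residual e u v h0
        exact ((hcont.eventually_lt_const hlt).filter_mono nhdsWithin_le_nhds).mono
          fun δ h => le_of_lt h
    obtain ⟨δ, h1, h2⟩ := (hev.and self_mem_nhdsWithin).exists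
    exact ⟨δ, h2, h1⟩
  obtain ⟨δ, hδ0, hδ⟩ := hδ
  have hnet : ∀ x, ∑ e, ∑ v, (f e x v + δ * g e x v) =
      ∑ e, ∑ v, f e x v + δ * ((if x = s then 1 else 0) - if x = t then 1 else 0) := fun x => by
    simp only [Finset.sum_add_distrib, ← Finset.mul_sum, hg.net]
  have hflow : IsFlow G s t fun e u v => f e u v + δ * g e u v := by
    refine ⟨fun e u v => ?_, fun e u v hn => ?_, hδ, fun u h1 h2 => ?_⟩
    · rw [hf.antisymm, hg.antisymm]; ring
    · rw [hf.support e u v hn, hg.support e u v hn]; simp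
    · rw [hnet, hf.conservation u h1 h2]; simp [h1, h2]
  have h1 := hmax _ hflow
  unfold flowValue at h1
  rw [hnet] at h1
  simp only [if_true, if_neg hst] at h1
  linarith

/-- For a maximum flow, take `S` to be the vertices reachable from `s` by residual arcs: every arc
leaving `S` is saturated. -/
theorem exists_flow_eq_cut (hst : s ≠ t) :
    ∃ f S, IsFlow G s t f ∧ s ∈ S ∧ t ∉ S ∧ flowValue G s f = (cutEdges G S).card := by
  obtain ⟨f, hf, hmax⟩ := exists_max_flow (G := G) s t
  refine ⟨f, {u | Relation.ReflTransGen (Residual G f) s u}, hf, .refl,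
    hf.not_reachable_of_max hst hmax, ?_⟩
  refine hf.flowValue_eq_of_saturated Relation.ReflTransGen.refl
    (hf.not_reachable_of_max hst hmax) fun e a b hab ha hb => ?_
  refine le_antisymm (hf.capacity e a b) ?_
  by_contra! hlt
  exact hb (Relation.ReflTransGen.tail ha ⟨e, hab, hlt⟩)

theorem flowValue_le_of_crosses {e : E(G)} (h : G.IsLink e s t) (hf : IsFlow G s t f)
    {S : Set V(G)} (hS : Crosses G S e) : flowValue G s f ≤ (cutEdges G S).card := by
  rw [crosses_iff h] at hS
  by_cases hs : s ∈ S
  · exact hf.flowValue_le hs (by tauto)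
  · rw [← cutEdges_compl]
    exact hf.flowValue_le (by simpa using hs) (by simp only [Set.mem_compl_iff]; tauto)

theorem connectivity_le {e : E(G)} {S : Set V(G)} (hS : Crosses G S e) :
    connectivity G e ≤ (cutEdges G S).card := by
  refine Real.sSup_le ?_ (Nat.cast_nonneg _)
  rintro _ ⟨s, t, h, f, hf, rfl⟩
  exact flowValue_le_of_crosses h hf hS

theorem exists_cut_le_connectivity [G.Loopless] (e : E(G)) :
    ∃ S, Crosses G S e ∧ ((cutEdges G S).card : ℝ) ≤ connectivity G e := by
  obtain ⟨s, t, h⟩ := exists_isLink e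
  obtain ⟨f, S, hf, hs, ht, heq⟩ := exists_flow_eq_cut (G := G) (s := s) (t := t)
    fun h' => h.ne (congrArg Subtype.val h')
  have hS : Crosses G S e := ⟨s, t, h, hs, ht⟩
  refine ⟨S, hS, heq ▸ le_csSup ⟨(cutEdges G S).card, ?_⟩ ⟨s, t, h, f, hf, rfl⟩⟩
  rintro _ ⟨s', t', h', f', hf', rfl⟩
  exact flowValue_le_of_crosses h' hf' hS

end MaxFlow

/-! ### Edge connectivity and forest decompositions -/

section Connectivity

open Classical

variable {α β : Type*} {G : Graph α β} [Fintype E(G)]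

/-- The size of a smallest cut crossed by the edge `e`. -/
noncomputable def edgeConn (G : Graph α β) [Fintype E(G)] (e : E(G)) : ℕ :=
  sInf {k | ∃ S, Crosses G S e ∧ (cutEdges G S).card = k}

theorem edgeConn_le {S : Set V(G)} {e : E(G)} (h : Crosses G S e) :
    edgeConn G e ≤ (cutEdges G S).card :=
  Nat.sInf_le ⟨S, h, rfl⟩

omit [Fintype E(G)] in
theorem exists_crosses [G.Loopless] (e : E(G)) : ∃ S, Crosses G S e := by
  obtain ⟨a, b, h⟩ := exists_isLink e
  exact ⟨{a}, a, b, h, rfl, fun h' => h.ne (congrArg Subtype.val (Eq.symm h'))⟩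

theorem exists_card_cutEdges_eq_edgeConn [G.Loopless] (e : E(G)) :
    ∃ S, Crosses G S e ∧ (cutEdges G S).card = edgeConn G e := by
  obtain ⟨S, hS⟩ := exists_crosses e
  exact Nat.sInf_mem (s := {k | ∃ S, Crosses G S e ∧ (cutEdges G S).card = k}) ⟨_, S, hS, rfl⟩

theorem one_le_edgeConn [G.Loopless] (e : E(G)) : 1 ≤ edgeConn G e := by
  obtain ⟨S, hS, h⟩ := exists_card_cutEdges_eq_edgeConn e
  rw [← h]
  exact Finset.card_pos.2 ⟨e, by simpa using hS⟩

theorem connectivity_eq_edgeConn [G.Loopless] [Fintype V(G)] (e : E(G)) :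
    connectivity G e = edgeConn G e := by
  obtain ⟨S, hS, h⟩ := exists_card_cutEdges_eq_edgeConn e
  obtain ⟨S', hS', h'⟩ := exists_cut_le_connectivity e
  refine le_antisymm (h ▸ connectivity_le hS) (le_trans ?_ h')
  exact_mod_cast edgeConn_le hS'

/-- The connectivity depends only on the two ends, so the bound is free of the number of parallel
edges. It limits the number of classes in the union bound. -/
theorem card_image_edgeConn_le [Fintype V(G)] :
    (Finset.univ.image (edgeConn G)).card ≤ Fintype.card V(G) ^ 2 := by
  let c : V(G) × V(G) → ℕ := fun p =>
    sInf {k | ∃ S : Set V(G), ¬ (p.1 ∈ S ↔ p.2 ∈ S) ∧ (cutEdges G S).card = k}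
  have hsub : Finset.univ.image (edgeConn G) ⊆ Finset.univ.image c := by
    intro k hk
    obtain ⟨e, -, rfl⟩ := Finset.mem_image.1 hk
    obtain ⟨a, b, h⟩ := exists_isLink e
    refine Finset.mem_image.2 ⟨(a, b), Finset.mem_univ _, ?_⟩
    simp only [c, edgeConn, crosses_iff h]
  refine (Finset.card_le_card hsub).trans (Finset.card_image_le.trans ?_)
  rw [Finset.card_univ, Fintype.card_prod, sq]

/-- Both ends of `e` lie in `W`. -/
def InsideEdge (G : Graph α β) (W : Finset V(G)) (e : E(G)) : Prop :=
  ∀ a b : V(G), G.IsLink e a b → a ∈ W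

/-- Divide `W` along a minimum cut `A` of the subgraph induced on `W`. A smallest cut of `G` through
an edge inside `W` restricts to a cut of that subgraph, so each of the `m A` edges between the parts
has connectivity at least `m A`, and together they contribute at most 1. Induction on both parts
gives `(|A| - 1) + (|W \ A| - 1) + 1`. -/
theorem sum_inv_edgeConn_inside_le [G.Loopless] (W : Finset V(G)) (hW : W.Nonempty) :
    ∑ e with InsideEdge G W e, (1 / edgeConn G e : ℝ) ≤ W.card - 1 := by
  induction hn : W.card using Nat.strong_induction_on generalizing W with
  | h n ih =>
  have hpos : 1 ≤ W.card := hW.card_pos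
  have hterm : ∀ e : E(G), (0 : ℝ) ≤ 1 / edgeConn G e := fun e => by positivity
  rcases Nat.lt_or_ge 1 W.card with h1 | h1
  swap
  · obtain ⟨x, rfl⟩ := Finset.card_eq_one.1 (le_antisymm h1 hpos)
    rw [Finset.sum_eq_zero]
    · subst hn; simp
    · intro e he
      exfalso
      have he := (Finset.mem_filter.1 he).2
      obtain ⟨a, b, hab⟩ := exists_isLink e
      have ha := Finset.mem_singleton.1 (he a b hab)
      have hb := Finset.mem_singleton.1 (he b a hab.symm)
      exact hab.ne (congrArg Subtype.val (ha.trans hb.symm))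
  · let m : Finset V(G) → ℕ := fun A =>
      (Finset.univ.filter fun e => InsideEdge G W e ∧ Crosses G (A : Set V(G)) e).card
    obtain ⟨x, hx, y, hy, hxy⟩ := Finset.one_lt_card.1 h1
    obtain ⟨A, hA, hAmin⟩ := Finset.exists_min_image (W.ssubsets.filter Finset.Nonempty) m
      ⟨{x}, by
        refine Finset.mem_filter.2 ⟨Finset.mem_ssubsets.2 ⟨by simpa using hx, fun h => ?_⟩, by simp⟩
        exact hxy (Finset.mem_singleton.1 (h hy)).symm⟩
    rw [Finset.mem_filter, Finset.mem_ssubsets] at hA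
    obtain ⟨hAW, hA0⟩ := hA
    have hconn : ∀ e, InsideEdge G W e → Crosses G (A : Set V(G)) e → m A ≤ edgeConn G e := by
      intro e he _
      obtain ⟨S, hS, hcard⟩ := exists_card_cutEdges_eq_edgeConn e
      obtain ⟨a, b, hab, ha, hb⟩ := hS
      refine (hAmin (W.filter (· ∈ S)) (Finset.mem_filter.2 ⟨Finset.mem_ssubsets.2
        ⟨Finset.filter_subset _ _, fun h => ?_⟩, ⟨a, ?_⟩⟩)).trans ?_
      · exact hb (Finset.mem_filter.1 (h (he b a hab.symm))).2
      · exact Finset.mem_filter.2 ⟨he a b hab, ha⟩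
      · rw [← hcard]
        refine Finset.card_le_card fun e' he' => ?_
        obtain ⟨hi, c, d, hcd, hc, hd⟩ := (Finset.mem_filter.1 he').2
        rw [Finset.mem_coe, Finset.mem_filter] at hc hd
        exact mem_cutEdges.2 ⟨c, d, hcd, hc.2, fun h => hd ⟨hi d c hcd.symm, h⟩⟩
    have hcross : ∑ e with InsideEdge G W e ∧ Crosses G (A : Set V(G)) e,
        (1 / edgeConn G e : ℝ) ≤ 1 := by
      rcases Nat.eq_zero_or_pos (m A) with h0 | h0
      · rw [Finset.card_eq_zero.1 h0]; simp
      · have hm : (0 : ℝ) < m A := by exact_mod_cast h0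
        calc _ ≤ ∑ e with InsideEdge G W e ∧ Crosses G (A : Set V(G)) e, (1 / m A : ℝ) := by
              refine Finset.sum_le_sum fun e he => ?_
              have he := (Finset.mem_filter.1 he).2
              exact one_div_le_one_div_of_le hm (by exact_mod_cast hconn e he.1 he.2)
          _ = 1 := by
              rw [Finset.sum_const, nsmul_eq_mul]
              exact mul_one_div_cancel hm.ne'
    have hcardA := Finset.card_lt_card hAW
    have hcardD := Finset.card_sdiff_add_card_eq_card hAW.1
    have hA1 := hA0.card_pos
    have iA := ih A.card (by omega) A hA0 rfl
    have iD := ih (W \ A).card (by omega) (W \ A) (Finset.card_pos.1 (by omega)) rfl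
    have hcover : Finset.univ.filter (InsideEdge G W) ⊆
        (Finset.univ.filter fun e => InsideEdge G W e ∧ Crosses G (A : Set V(G)) e) ∪
        (Finset.univ.filter (InsideEdge G A) ∪ Finset.univ.filter (InsideEdge G (W \ A))) := by
      intro e he
      have he := (Finset.mem_filter.1 he).2
      simp only [Finset.mem_union, Finset.mem_filter, Finset.mem_univ, true_and]
      by_cases hc : Crosses G (A : Set V(G)) e
      · exact Or.inl ⟨he, hc⟩
      right
      by_cases hin : InsideEdge G A e
      · exact Or.inl hin
      right
      intro a b hab
      refine Finset.mem_sdiff.2 ⟨he a b hab, fun ha => hin fun c d hcd => ?_⟩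
      rw [crosses_iff hcd, not_not] at hc
      rcases hab.eq_and_eq_or_eq_and_eq hcd with ⟨h2, h3⟩ | ⟨h2, h3⟩
      · exact Subtype.ext h2 ▸ ha
      · exact hc.2 (Subtype.ext h2 ▸ ha)
    have hunion : ∀ B C : Finset E(G), ∑ e ∈ B ∪ C, (1 / edgeConn G e : ℝ) ≤
        ∑ e ∈ B, (1 / edgeConn G e : ℝ) + ∑ e ∈ C, (1 / edgeConn G e : ℝ) := fun B C => by
      rw [← Finset.sum_union_inter]
      exact le_add_of_nonneg_right (Finset.sum_nonneg fun e _ => hterm e)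
    have hsum := (Finset.sum_le_sum_of_subset_of_nonneg hcover fun e _ _ => hterm e).trans
      ((hunion _ _).trans (add_le_add_right (hunion _ _) _))
    have hcast : ((W \ A).card : ℝ) + A.card = n := by
      rw [← hn]; exact_mod_cast hcardD
    linarith

theorem sum_inv_edgeConn_le [G.Loopless] [Fintype V(G)] :
    ∑ e, (1 / edgeConn G e : ℝ) ≤ Fintype.card V(G) := by
  rcases isEmpty_or_nonempty V(G) with h | h
  · have : IsEmpty E(G) := ⟨fun e => by
      obtain ⟨a, -⟩ := exists_isLink e
      exact h.elim a⟩
    simp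
  · have h1 := sum_inv_edgeConn_inside_le (G := G) Finset.univ Finset.univ_nonempty
    rw [Finset.filter_true_of_mem fun e _ a b _ => Finset.mem_univ a, Finset.card_univ] at h1
    linarith

omit [Fintype E(G)] in
-- A spanning forest obtained by linear algebra: `T` is a basis among the incidence vectors `1_a -
-- 1_b`. Summing coordinates over `S` is a functional that vanishes exactly on the edges not
-- crossing `S`, so if it vanishes on `T` it vanishes on `F`.
theorem exists_small_subset_crossing [Fintype V(G)] (F : Finset E(G)) :
    ∃ T ⊆ F, T.card ≤ Fintype.card V(G) ∧
      ∀ S, (∃ e ∈ F, Crosses G S e) → ∃ e ∈ T, Crosses G S e := by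
  choose a b hab using fun e : E(G) => exists_isLink e
  let w : E(G) → V(G) → ℚ := fun e => Pi.single (a e) 1 - Pi.single (b e) 1
  obtain ⟨κ, i, hi, hspan, hli⟩ := exists_linearIndependent' ℚ (fun e : F => w e)
  have : Fintype κ := Fintype.ofInjective i hi
  refine ⟨Finset.univ.image fun k => (i k : E(G)), ?_, ?_, ?_⟩
  · intro e he
    obtain ⟨k, -, rfl⟩ := Finset.mem_image.1 he
    exact (i k).2
  · refine Finset.card_image_le.trans ?_
    have := hli.fintype_card_le_finrank
    rwa [Module.finrank_fintype_fun_eq_card] at this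
  · rintro S ⟨e, he, hS⟩
    by_contra! hT
    let φ : (V(G) → ℚ) →ₗ[ℚ] ℚ := ∑ x with x ∈ S, LinearMap.proj x
    have hφ : ∀ e, φ (w e) = (if a e ∈ S then 1 else 0) - if b e ∈ S then 1 else 0 := by
      intro e
      simp [φ, w, Finset.sum_sub_distrib, Pi.single_apply]
    have hle : Submodule.span ℚ (Set.range fun e : F => w e) ≤ LinearMap.ker φ := by
      rw [← hspan, Submodule.span_le]
      rintro _ ⟨k, rfl⟩
      have hk := hT _ (Finset.mem_image_of_mem _ (Finset.mem_univ k))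
      rw [crosses_iff (hab _), not_not] at hk
      change φ (w (i k)) = 0
      rw [hφ]
      simp [hk]
    have h0 : φ (w e) = 0 := hle (Submodule.subset_span ⟨⟨e, he⟩, rfl⟩)
    rw [crosses_iff (hab e)] at hS
    rw [hφ] at h0
    by_cases h1 : a e ∈ S <;> by_cases h2 : b e ∈ S <;> simp [h1, h2] at h0 hS

omit [Fintype E(G)] in
/-- A decomposition of a set of edges into successive spanning forests: level `j` consists of few
edges, and a cut that is missed by level `j` is missed by all later levels. -/
theorem exists_forest_level_on [G.Loopless] [Fintype V(G)] (F : Finset E(G)) :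
    ∃ l : E(G) → ℕ, (∀ j, (F.filter fun e => l e = j).card ≤ Fintype.card V(G)) ∧
      ∀ S j, (∀ e ∈ F, Crosses G S e → l e ≠ j) → ∀ e ∈ F, Crosses G S e → l e < j := by
  induction hn : F.card using Nat.strong_induction_on generalizing F with
  | h n ih =>
  rcases F.eq_empty_or_nonempty with rfl | ⟨e₀, he₀⟩
  · exact ⟨fun _ => 0, by simp, by simp⟩
  obtain ⟨T, hTF, hTcard, hT⟩ := exists_small_subset_crossing F
  have hTne : T.Nonempty := by
    obtain ⟨S, hS⟩ := exists_crosses e₀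
    obtain ⟨e, he, -⟩ := hT S ⟨e₀, he₀, hS⟩
    exact ⟨e, he⟩
  have hc := Finset.card_sdiff_add_card_eq_card hTF
  have hT1 := hTne.card_pos
  obtain ⟨l, h1, h2⟩ := ih (F \ T).card (by omega) (F \ T) rfl
  -- The forest `T` becomes level 0, and the levels of the remaining edges move up by one.
  refine ⟨fun e => if e ∈ T then 0 else l e + 1, fun j => ?_, fun S j hj e he hS => ?_⟩
  · cases j with
    | zero =>
      refine (Finset.card_le_card fun e he => ?_).trans hTcard
      have := (Finset.mem_filter.1 he).2
      by_contra hT'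
      simp [hT'] at this
    | succ j =>
      refine (Finset.card_le_card fun e he => ?_).trans (h1 j)
      rw [Finset.mem_filter] at he
      by_cases hT' : e ∈ T
      · simp [hT'] at he
      · simpa [hT'] using he
  · cases j with
    | zero =>
      obtain ⟨e', he', hS'⟩ := hT S ⟨e, he, hS⟩
      exact absurd (by simp [he']) (hj e' (hTF he') hS')
    | succ j =>
      by_cases hT' : e ∈ T
      · simp [hT']
      · have := h2 S j (fun e' he' hS' hl => ?_) e (Finset.mem_sdiff.2 ⟨he, hT'⟩) hS
        · simpa [hT'] using this
        · rw [Finset.mem_sdiff] at he'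
          exact hj e' he'.1 hS' (by simp [he'.2, hl])

/-- Either the cut has an edge on every level below `M`, or it misses one such level and then lies
entirely below it. -/
theorem exists_forest_level (G : Graph α β) [Fintype E(G)] [G.Loopless] [Fintype V(G)] :
    ∃ l : E(G) → ℕ, (∀ j, (Finset.univ.filter fun e => l e = j).card ≤ Fintype.card V(G)) ∧
      ∀ S M, M ≤ (cutEdges G S).card → M ≤ ((cutEdges G S).filter fun e => l e < M).card := by
  obtain ⟨l, h1, h2⟩ := exists_forest_level_on (G := G) Finset.univ
  refine ⟨l, h1, fun S M hM => ?_⟩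
  by_cases hall : ∀ j < M, ∃ e, Crosses G S e ∧ l e = j
  · calc M = (Finset.range M).card := (Finset.card_range M).symm
      _ ≤ (((cutEdges G S).filter fun e => l e < M).image l).card := by
          refine Finset.card_le_card fun j hj => ?_
          rw [Finset.mem_range] at hj
          obtain ⟨e, he, rfl⟩ := hall j hj
          exact Finset.mem_image_of_mem _ (Finset.mem_filter.2 ⟨mem_cutEdges.2 he, hj⟩)
      _ ≤ _ := Finset.card_image_le
  · push Not at hall
    obtain ⟨j, hj, hne⟩ := hall
    rwa [Finset.filter_true_of_mem]
    exact fun e he => (h2 S j (fun e _ => hne e) e (Finset.mem_univ _) (mem_cutEdges.1 he)).trans hj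

end Connectivity

/-! ### Concentration of the sampled weights -/

section Concentration

open Classical

theorem exp_le_one_add_add_sq {x : ℝ} (hx : |x| ≤ 1) : Real.exp x ≤ 1 + x + x ^ 2 := by
  have := (abs_le.1 (Real.abs_exp_sub_one_sub_id_le hx)).2
  linarith

/-- The centred variable has mean zero and variance `(1 - q) / q ≤ 1 / p`, and `|s| ≤ p ≤ q` keeps
both exponents in `[-1, 1]`, where `exp x ≤ 1 + x + x ^ 2`. An edge with `q = 1` is deterministic
and needs no relation to `p`. -/
theorem bernoulli_mgf_le {p q s : ℝ} (hp : 0 < p) (hq0 : 0 < q) (hq1 : q ≤ 1)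
    (hpq : q = 1 ∨ p ≤ q) (hs : |s| ≤ p) :
    q * Real.exp (s * (1 / q - 1)) + (1 - q) * Real.exp (s * (0 - 1)) ≤ Real.exp (s ^ 2 / p) := by
  rcases hpq with rfl | hpq
  · simpa using by positivity
  have h0 : 0 ≤ 1 / q - 1 := by
    rw [sub_nonneg, le_div_iff₀ hq0]; linarith
  have h1 : |s * (1 / q - 1)| ≤ 1 := by
    rw [abs_mul, abs_of_nonneg h0]
    calc |s| * (1 / q - 1) ≤ q * (1 / q - 1) := by gcongr; linarith
      _ = 1 - q := by field_simp
      _ ≤ 1 := by linarith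
  have h2 : |s * (0 - 1)| ≤ 1 := by
    rw [zero_sub, mul_neg_one, abs_neg]; linarith
  calc _ ≤ q * (1 + s * (1 / q - 1) + (s * (1 / q - 1)) ^ 2) +
        (1 - q) * (1 + s * (0 - 1) + (s * (0 - 1)) ^ 2) := by
        exact add_le_add (mul_le_mul_of_nonneg_left (exp_le_one_add_add_sq h1) hq0.le)
          (mul_le_mul_of_nonneg_left (exp_le_one_add_add_sq h2) (by linarith))
    _ = 1 + s ^ 2 * (1 - q) / q := by field_simp; ring
    _ ≤ 1 + s ^ 2 / p := by
        have : s ^ 2 * (1 - q) / q ≤ s ^ 2 / p := by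
          rw [div_le_div_iff₀ hq0 hp]
          nlinarith [sq_nonneg s, mul_nonneg (sq_nonneg s) hq0.le,
            mul_nonneg (sq_nonneg s) hp.le, mul_nonneg (mul_nonneg (sq_nonneg s) hp.le) hq0.le,
            mul_nonneg (sq_nonneg s) (sub_nonneg.2 hpq)]
        linarith
    _ ≤ _ := by
        have := Real.add_one_le_exp (s ^ 2 / p)
        linarith

variable {ι : Type*} [Fintype ι]

/-- The law of independent coins with biases `q`. -/
noncomputable def coinLaw (q : ι → I) : Measure (ι → Bool) :=
  Measure.pi fun e => bernoulliMeasure true false (q e)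

instance (q : ι → I) : IsProbabilityMeasure (coinLaw q) := by
  unfold coinLaw; infer_instance

/-- The deviation of the weight of the sampled part of `A` from its mean. -/
noncomputable def deviation (q : ι → I) (A : Finset ι) (ω : ι → Bool) : ℝ :=
  ∑ e ∈ A, ((if ω e then 1 / (q e : ℝ) else 0) - 1)

theorem mgf_deviation_le {q : ι → I} {A : Finset ι} {p s : ℝ} (hp : 0 < p)
    (hq : ∀ e ∈ A, 0 < (q e : ℝ) ∧ ((q e : ℝ) = 1 ∨ p ≤ q e)) (hs : |s| ≤ p) :
    mgf (deviation q A) (coinLaw q) s ≤ Real.exp (s ^ 2 * A.card / p) := by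
  -- Coins outside `A` get the factor 1, so that the product runs over all coins and independence
  -- applies.
  let h : ι → Bool → ℝ := fun e b =>
    if e ∈ A then Real.exp (s * ((if b then 1 / (q e : ℝ) else 0) - 1)) else 1
  have h1 : ∀ ω, Real.exp (s * deviation q A ω) = ∏ e, h e (ω e) := by
    intro ω
    rw [deviation, Finset.mul_sum, Real.exp_sum, Finset.prod_ite_mem, Finset.univ_inter]
  have h2 : ∀ e, ∫ b, h e b ∂bernoulliMeasure true false (q e) ≤
      if e ∈ A then Real.exp (s ^ 2 / p) else 1 := by
    intro e
    by_cases he : e ∈ A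
    · obtain ⟨hq0, hq1⟩ := hq e he
      have := bernoulli_mgf_le hp hq0 (q e).2.2 hq1 hs
      simp only [h, he, if_true, integral_bernoulliMeasure, smul_eq_mul]
      simpa using this
    · simp [h, he]
  unfold mgf coinLaw
  simp only [h1]
  rw [integral_fintype_prod_eq_prod (𝕜 := ℝ)]
  calc _ ≤ ∏ e, (if e ∈ A then Real.exp (s ^ 2 / p) else 1) := by
        refine Finset.prod_le_prod (fun e _ => integral_nonneg fun b => ?_) fun e _ => h2 e
        by_cases he : e ∈ A
        · simp only [h, he, if_true]; positivity
        · simp [h, he]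
    _ = _ := by
        rw [Finset.prod_ite_mem, Finset.univ_inter, Finset.prod_const, ← Real.exp_nat_mul]
        congr 1
        ring

theorem measure_deviation_gt_le {q : ι → I} {A : Finset ι} {p s : ℝ} (hp : 0 < p)
    (hq : ∀ e ∈ A, 0 < (q e : ℝ) ∧ ((q e : ℝ) = 1 ∨ p ≤ q e)) (hs0 : 0 ≤ s) (hs : s ≤ p) (t : ℝ) :
    (coinLaw q).real {ω | t < |deviation q A ω|} ≤ 2 * Real.exp (s ^ 2 * A.card / p - s * t) := by
  have hint : ∀ c, Integrable (fun ω => Real.exp (c * deviation q A ω)) (coinLaw q) :=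
    fun c => Integrable.of_finite
  have h1 := measure_ge_le_exp_mul_mgf (X := deviation q A) (μ := coinLaw q) t hs0 (hint s)
  have h2 := measure_le_le_exp_mul_mgf (X := deviation q A) (μ := coinLaw q) (-t)
    (neg_nonpos.2 hs0) (hint (-s))
  have m1 := mgf_deviation_le hp hq (s := s) (by rwa [abs_of_nonneg hs0])
  have m2 := mgf_deviation_le hp hq (s := -s) (by rwa [abs_neg, abs_of_nonneg hs0])
  have hsub : {ω | t < |deviation q A ω|} ⊆
      {ω | t ≤ deviation q A ω} ∪ {ω | deviation q A ω ≤ -t} := by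
    intro ω hω
    rcases lt_abs.1 (show t < |deviation q A ω| from hω) with h | h
    · exact Or.inl h.le
    · exact Or.inr (show deviation q A ω ≤ -t by linarith)
  have e1 : Real.exp (-s * t) * Real.exp (s ^ 2 * A.card / p) =
      Real.exp (s ^ 2 * A.card / p - s * t) := by
    rw [← Real.exp_add]; congr 1; ring
  rw [neg_sq] at m2
  rw [neg_neg, mul_neg, ← neg_mul] at h2
  have h3 := h1.trans (mul_le_mul_of_nonneg_left m1 (Real.exp_nonneg _))
  have h4 := h2.trans (mul_le_mul_of_nonneg_left m2 (Real.exp_nonneg _))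
  rw [e1] at h3 h4
  calc _ ≤ _ := measureReal_mono hsub
    _ ≤ _ := measureReal_union_le _ _
    _ ≤ _ := by linarith

theorem integral_ncard_eq_sum (q : ι → I) :
    ∫ ω, (({e | ω e = true} : Set ι).ncard : ℝ) ∂coinLaw q = ∑ e, (q e : ℝ) := by
  have h1 : ∀ ω : ι → Bool, (({e | ω e = true} : Set ι).ncard : ℝ) =
      ∑ e, if ω e then (1 : ℝ) else 0 := by
    intro ω
    rw [Set.ncard_eq_toFinset_card', Finset.sum_boole]
    simp
  simp only [h1]
  rw [integral_finsetSum _ fun e _ => Integrable.of_finite]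
  refine Finset.sum_congr rfl fun e _ => ?_
  refine (integral_comp_eval (μ := fun e => bernoulliMeasure true false (q e)) (i := e)
    (f := fun b : Bool => if b then (1 : ℝ) else 0) AEStronglyMeasurable.of_discrete).trans ?_
  rw [integral_bernoulliMeasure]
  simp

end Concentration

/-! ### Connectivity classes, forest layers and the union bound -/

section Layers

open Classical

variable {α β : Type*} {G : Graph α β} [Fintype E(G)]

/-- The edges whose connectivity lies in `[2 ^ i, 2 ^ (i + 1))`. -/
noncomputable def connClass (G : Graph α β) [Fintype E(G)] (i : ℕ) : Finset E(G) :=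
  Finset.univ.filter fun e => Nat.log 2 (edgeConn G e) = i

/-- The edges of the forests that certify the connectivities of the `i`-th class. -/
noncomputable def layer [Fintype V(G)] (l : E(G) → ℕ) (i : ℕ) : Finset E(G) :=
  Finset.univ.filter fun e => 2 ^ i < 2 * Fintype.card V(G) * (l e + 1) ∧ l e < 2 ^ i

/-- The number of edges of the `i`-th layer that cross the cut `S`. -/
noncomputable def layerCut [Fintype V(G)] (l : E(G) → ℕ) (i : ℕ) (S : Set V(G)) : ℕ :=
  (cutEdges G S ∩ layer l i).card

theorem two_pow_le_edgeConn [G.Loopless] {i : ℕ} {e : E(G)} (he : e ∈ connClass G i) :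
    2 ^ i ≤ edgeConn G e := by
  rw [← (Finset.mem_filter.1 he).2]
  exact Nat.pow_log_le_self 2 (by have := one_le_edgeConn e; omega)

theorem edgeConn_lt_two_pow {i : ℕ} {e : E(G)} (he : e ∈ connClass G i) :
    edgeConn G e < 2 ^ (i + 1) := by
  rw [← (Finset.mem_filter.1 he).2]
  exact Nat.lt_pow_succ_log_self (by norm_num) _

variable [Fintype V(G)]

/-- The edge levels come from successive spanning forests. -/
def IsForestLevel (G : Graph α β) [Fintype V(G)] [Fintype E(G)] (l : E(G) → ℕ) : Prop :=
  (∀ j, (Finset.univ.filter fun e => l e = j).card ≤ Fintype.card V(G)) ∧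
    ∀ S M, M ≤ (cutEdges G S).card → M ≤ ((cutEdges G S).filter fun e => l e < M).card

/-- The first `2 ^ i` levels contain `2 ^ i` edges of the cut. Those outside the layer lie on the
lowest `2 ^ i / (2n)` levels of at most `n` edges each, hence are at most half of `2 ^ i`. -/
theorem IsForestLevel.two_pow_le {l : E(G) → ℕ} (hl : IsForestLevel G l) {i : ℕ} {S : Set V(G)}
    (h : 2 ^ i ≤ (cutEdges G S).card) : 2 ^ i ≤ 2 * layerCut l i S := by
  let j₀ := 2 ^ i / (2 * Fintype.card V(G))
  have hsub : ((cutEdges G S).filter fun e => l e < 2 ^ i) ⊆ (cutEdges G S ∩ layer l i) ∪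
      (Finset.range j₀).biUnion fun j => Finset.univ.filter fun e => l e = j := by
    intro e he
    rw [Finset.mem_filter] at he
    simp only [Finset.mem_union, Finset.mem_inter, layer, Finset.mem_filter, Finset.mem_univ,
      true_and, Finset.mem_biUnion, Finset.mem_range, exists_eq_right', he.1, he.2, and_true]
    by_cases hlt : 2 ^ i < 2 * Fintype.card V(G) * (l e + 1)
    · exact Or.inl hlt
    · right
      obtain ⟨a, -⟩ := exists_isLink e
      have : 0 < Fintype.card V(G) := Fintype.card_pos_iff.2 ⟨a⟩
      refine Nat.lt_of_succ_le ((Nat.le_div_iff_mul_le (by positivity)).2 ?_)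
      rw [mul_comm]
      exact not_lt.1 hlt
  have h1 := (hl.2 S _ h).trans ((Finset.card_le_card hsub).trans (Finset.card_union_le _ _))
  have h2 : ((Finset.range j₀).biUnion fun j => Finset.univ.filter fun e => l e = j).card ≤
      j₀ * Fintype.card V(G) := by
    simpa using Finset.card_biUnion_le_card_mul (Finset.range j₀) _ _ fun j _ => hl.1 j
  have h3 : j₀ * (2 * Fintype.card V(G)) ≤ 2 ^ i := Nat.div_mul_le_self _ _
  unfold layerCut
  nlinarith

/-- Membership in layer `i` confines `2 ^ i` to the range from `l e + 1` to `2n (l e + 1)`. -/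
theorem card_layers_le (l : E(G) → ℕ) (J : Finset ℕ) (e : E(G)) :
    (J.filter fun i => e ∈ layer l i).card ≤ Nat.log 2 (Fintype.card V(G)) + 2 := by
  rcases (J.filter fun i => e ∈ layer l i).eq_empty_or_nonempty with h0 | hne
  · simp [h0]
  obtain ⟨i₀, hi₀, hmin⟩ := Finset.exists_min_image _ id hne
  have hi₀ := (Finset.mem_filter.1 (Finset.mem_filter.1 hi₀).2).2
  have hsub : (J.filter fun i => e ∈ layer l i) ⊆
      Finset.Ico i₀ (i₀ + (Nat.log 2 (Fintype.card V(G)) + 2)) := by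
    intro i hi
    have h1 : i₀ ≤ i := hmin i hi
    have h2 := (Finset.mem_filter.1 (Finset.mem_filter.1 hi).2).2
    rw [Finset.mem_Ico]
    refine ⟨h1, ?_⟩
    by_contra! hge
    have h3 : Fintype.card V(G) < 2 ^ (Nat.log 2 (Fintype.card V(G)) + 1) :=
      Nat.lt_pow_succ_log_self (by norm_num) _
    have h4 : 2 ^ (i₀ + (Nat.log 2 (Fintype.card V(G)) + 2)) ≤ 2 ^ i :=
      Nat.pow_le_pow_right (by norm_num) hge
    have h5 : 2 ^ (i₀ + (Nat.log 2 (Fintype.card V(G)) + 2)) =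
        2 * 2 ^ (Nat.log 2 (Fintype.card V(G)) + 1) * 2 ^ i₀ := by ring
    have h6 : 2 * Fintype.card V(G) * (l e + 1) ≤
        2 * 2 ^ (Nat.log 2 (Fintype.card V(G)) + 1) * 2 ^ i₀ :=
      Nat.mul_le_mul (by omega) hi₀.2
    omega
  simpa using Finset.card_le_card hsub

theorem sum_layerCut_le (l : E(G) → ℕ) (J : Finset ℕ) (S : Set V(G)) :
    ∑ i ∈ J, layerCut l i S ≤ (cutEdges G S).card * (Nat.log 2 (Fintype.card V(G)) + 2) := by
  have h : ∀ i, layerCut l i S = ∑ e ∈ cutEdges G S, if e ∈ layer l i then 1 else 0 := by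
    intro i
    rw [layerCut, ← Finset.filter_mem_eq_inter, Finset.card_filter]
  simp only [h]
  rw [Finset.sum_comm, ← smul_eq_mul]
  refine Finset.sum_le_card_nsmul _ _ _ fun e _ => ?_
  rw [← Finset.card_filter]
  exact card_layers_le l J e

/-- The possible intersections of the `i`-th connectivity class with the cuts of size about
`b * 2 ^ i / 4` in the `i`-th layer. -/
noncomputable def traces (l : E(G) → ℕ) (i b : ℕ) : Finset (Finset E(G)) :=
  (Finset.univ.filter fun S : Set V(G) => 4 * layerCut l i S / 2 ^ i = b).image
    fun S => cutEdges G S ∩ connClass G i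

theorem card_traces_le [G.Loopless] {l : E(G) → ℕ} (hl : IsForestLevel G l) (i b : ℕ)
    (hV : 0 < Fintype.card V(G)) :
    (traces l i b).card ≤ (2 * Fintype.card V(G)) ^ (b + 1) := by
  choose x y hxy using fun e : E(G) => exists_isLink e
  -- The terminal pairs are those not separated by fewer than `2 ^ i` edges; they include the ends
  -- of all edges of class `i`.
  let r : V(G) → V(G) → Prop := fun a b =>
    ∀ S : Set V(G), ¬ (a ∈ S ↔ b ∈ S) → 2 ^ i ≤ (cutEdges G S).card
  -- Four copies make all cuts even and turn the guarantee `2 ^ i / 2` into `2 * 2 ^ i`, which is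
  -- the hypothesis of the counting lemma with `K = 2 ^ i`.
  let M : Multiset (Sym2 V(G)) := 4 • (layer l i).val.map fun e => s(x e, y e)
  have hM : ∀ S, cutSize M S = 4 * layerCut l i S := by
    intro S
    simp only [cutSize, M, Multiset.countP_nsmul, Multiset.countP_map, splitBy_mk,
      ← crosses_iff (hxy _)]
    rw [layerCut, Finset.inter_comm, ← Finset.filter_mem_eq_inter]
    simp only [mem_cutEdges]
    rfl
  obtain ⟨𝒮, hsub, hinj, himg⟩ := Finset.exists_subset_injOn_image_eq_of_surjOn
    (f := fun S : Set V(G) => cutEdges G S ∩ connClass G i)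
    (Finset.univ.filter fun S : Set V(G) => 4 * layerCut l i S / 2 ^ i = b) (traces l i b)
    (by intro A hA; simpa [traces] using hA)
  have hcard : (traces l i b).card = 𝒮.card := by
    rw [← himg, Finset.card_image_of_injOn hinj]
  rw [hcard]
  refine card_small_cuts_le_pow (m := b + 1) (K := 2 ^ i) (by positivity) (r := r) (E := M)
    ?_ ?_ ?_ ?_ ?_ hV
  · intro a b hab S hS
    exact hab S (by tauto)
  · intro S
    rw [hM]
    exact (by decide : Even 4).mul_right _
  · rintro S ⟨a, b, hab, ha, hb⟩
    have := hl.two_pow_le (hab S (by tauto))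
    rw [hM]
    omega
  · intro S hS
    have := (Finset.mem_filter.1 (hsub hS)).2
    rw [hM, ← this, mul_comm (_ + 1)]
    exact (Nat.lt_mul_div_succ _ (by positivity)).le
  · intro S hS T hT hST
    refine hinj hS hT ?_
    ext e
    simp only [Finset.mem_inter, mem_cutEdges, crosses_iff (hxy e)]
    refine and_congr_left fun he => not_congr (hST _ _ fun U hU => ?_)
    exact (two_pow_le_edgeConn he).trans (edgeConn_le ((crosses_iff (hxy e)).2 hU))

end Layers

/-! ### The sampled skeleton -/

section Sampling

open Classical

variable {α β : Type*} {G : Graph α β} [Fintype V(G)] [Fintype E(G)]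

/-- The sampling probabilities as points of the unit interval. -/
noncomputable def sampleProbI (G : Graph α β) [Fintype V(G)] [Fintype E(G)] (ε : ℝ) (e : E(G)) : I :=
  ⟨sampleProb G ε e, sampleProb_mem G ε e⟩

theorem sampleLaw_eq_coinLaw (ε : ℝ) : sampleLaw G ε = coinLaw (sampleProbI G ε) := rfl

/-- The numerator of the sampling probabilities. -/
noncomputable def sampleRate (n : ℕ) (ε : ℝ) : ℝ :=
  96 * (3 + Real.logb 2 n) * Real.log n / (0.38 * ε ^ 2)

theorem sampleProb_eq [G.Loopless] (ε : ℝ) (e : E(G)) :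
    sampleProb G ε e = min (sampleRate (Fintype.card V(G)) ε / edgeConn G e) 1 := by
  rw [sampleProb, connectivity_eq_edgeConn, sampleRate, div_div]
  congr 2
  ring

omit [Fintype E(G)] in
theorem two_le_card_of_edge [G.Loopless] (e : E(G)) : 2 ≤ Fintype.card V(G) := by
  obtain ⟨a, b, h⟩ := exists_isLink e
  exact Fintype.one_lt_card_iff.2 ⟨a, b, fun h' => h.ne (congrArg Subtype.val h')⟩

theorem logb_two_nonneg (n : ℕ) : 0 ≤ Real.logb 2 n :=
  div_nonneg (Real.log_natCast_nonneg _) (Real.log_nonneg (by norm_num))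

theorem sampleRate_pos {n : ℕ} (hn : 2 ≤ n) {ε : ℝ} (hε : 0 < ε) : 0 < sampleRate n ε := by
  have h1 := logb_two_nonneg n
  have h2 : 0 < Real.log n := Real.log_pos (by exact_mod_cast hn)
  unfold sampleRate
  positivity

theorem sampleRate_le {n : ℕ} (hn : 2 ≤ n) {ε : ℝ} (hε : 0 < ε) :
    sampleRate n ε ≤ 1600 * (Real.log n ^ 2 / ε ^ 2) := by
  have h2 : 0 < Real.log 2 := Real.log_pos (by norm_num)
  have h3 : Real.log 2 ≤ Real.log n := Real.log_le_log (by norm_num) (by exact_mod_cast hn)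
  have h4 := Real.log_two_gt_d9
  -- Since `log n ≥ log 2 > 2 / 3`, both `3 ≤ 4.5 log n` and `logb 2 n ≤ 1.5 log n` hold. The
  -- constant 1600 exceeds `96 * 6 / 0.38`.
  have h5 : 3 + Real.logb 2 n ≤ 6 * Real.log n := by
    have h6 : Real.logb 2 n ≤ 1.5 * Real.log n := by
      rw [Real.logb, div_le_iff₀ h2]
      nlinarith
    linarith
  rw [sampleRate, ← div_div, mul_div_assoc', div_le_div_iff_of_pos_right (by positivity),
    div_le_iff₀ (by norm_num)]
  nlinarith [mul_le_mul_of_nonneg_right h5 (h2.trans_le h3).le]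

theorem integral_ncard_edges_le [G.Loopless] {ε : ℝ} (hε : 0 < ε) :
    ∫ ω, ((sampledSkeleton G ε ω).edges.ncard : ℝ) ∂sampleLaw G ε ≤
      1600 * (Fintype.card V(G) * Real.log (Fintype.card V(G)) ^ 2 / ε ^ 2) := by
  rcases isEmpty_or_nonempty E(G) with h | ⟨⟨e₀⟩⟩
  · have h0 : ∫ ω, ((sampledSkeleton G ε ω).edges.ncard : ℝ) ∂sampleLaw G ε = 0 := by
      rw [sampleLaw_eq_coinLaw]
      exact (integral_ncard_eq_sum _).trans (by simp)
    rw [h0]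
    positivity
  · have hn := two_le_card_of_edge e₀
    have hr := sampleRate_pos hn hε
    rw [sampleLaw_eq_coinLaw]
    calc _ = ∑ e, sampleProb G ε e := integral_ncard_eq_sum _
      _ ≤ ∑ e, sampleRate (Fintype.card V(G)) ε * (1 / edgeConn G e) := by
          refine Finset.sum_le_sum fun e _ => ?_
          rw [sampleProb_eq, mul_one_div]
          exact min_le_left _ _
      _ ≤ sampleRate (Fintype.card V(G)) ε * Fintype.card V(G) := by
          rw [← Finset.mul_sum]
          exact mul_le_mul_of_nonneg_left sum_inv_edgeConn_le hr.le
      _ ≤ 1600 * (Real.log (Fintype.card V(G)) ^ 2 / ε ^ 2) * Fintype.card V(G) :=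
          mul_le_mul_of_nonneg_right (sampleRate_le hn hε) (Nat.cast_nonneg _)
      _ = _ := by ring

/-- The deviation tolerated in the `i`-th connectivity class. -/
noncomputable def tolerance (n : ℕ) (ε : ℝ) (i b : ℕ) (A : Finset E(G)) : ℝ :=
  ε / 2 * (A.card + b * 2 ^ i / (4 * (3 + Real.logb 2 n)))

/-- Put `p = sampleRate / 2 ^ (i + 1)`, a lower bound for the unsaturated probabilities in the
class, and `s = ε p / 2`. Then the variance term `s ^ 2 |A| / p` cancels the `|A|` part of the
tolerance exactly. What is left in the exponent is `-(96 / (32 * 0.38)) b log n`, and this factor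
exceeds 7. -/
theorem measure_tolerance_lt_le [G.Loopless] {ε : ℝ} (hε : 0 < ε) (hε1 : ε ≤ 1) {i b : ℕ}
    {A : Finset E(G)} (hA : A ⊆ connClass G i) (hn : 2 ≤ Fintype.card V(G)) :
    (sampleLaw G ε).real {ω | tolerance (Fintype.card V(G)) ε i b A <
      |deviation (sampleProbI G ε) A ω|} ≤ 2 * ((Fintype.card V(G) : ℝ) ^ (7 * b))⁻¹ := by
  set n := Fintype.card V(G)
  have hr := sampleRate_pos hn hε
  have hγ := logb_two_nonneg n
  have hL : 0 < Real.log n := Real.log_pos (by exact_mod_cast hn)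
  have hp : 0 < sampleRate n ε / 2 ^ (i + 1) := by positivity
  refine (measure_deviation_gt_le (s := ε / 2 * (sampleRate n ε / 2 ^ (i + 1))) hp ?_
    (by positivity) ?_ _).trans ?_
  · intro e he
    have h1 : (0 : ℝ) < edgeConn G e := by exact_mod_cast one_le_edgeConn e
    have h2 : (edgeConn G e : ℝ) ≤ 2 ^ (i + 1) := by
      exact_mod_cast (edgeConn_lt_two_pow (hA he)).le
    change 0 < sampleProb G ε e ∧ (sampleProb G ε e = 1 ∨ _ ≤ sampleProb G ε e)
    rw [sampleProb_eq]
    refine ⟨lt_min (by positivity) one_pos, ?_⟩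
    rcases le_total (sampleRate n ε / edgeConn G e) 1 with h | h
    · right
      rw [min_eq_left h]
      exact div_le_div_of_nonneg_left hr.le h1 h2
    · exact Or.inl (min_eq_right h)
  · exact mul_le_of_le_one_left hp.le (by linarith)
  · have hpow : ((n : ℝ) ^ (7 * b))⁻¹ = Real.exp (-(7 * b * Real.log n)) := by
      rw [Real.exp_neg, ← Real.rpow_natCast, Real.rpow_def_of_pos (by positivity)]
      push_cast
      ring_nf
    rw [hpow]
    gcongr
    have key : (ε / 2 * (sampleRate n ε / 2 ^ (i + 1))) ^ 2 * A.card /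
        (sampleRate n ε / 2 ^ (i + 1)) - ε / 2 * (sampleRate n ε / 2 ^ (i + 1)) *
        tolerance n ε i b A = -(96 / (32 * 0.38) * b * Real.log n) := by
      have hγ' : 3 + Real.logb 2 n ≠ 0 := by positivity
      have h3 : (ε / 2 * (sampleRate n ε / 2 ^ (i + 1))) ^ 2 * A.card /
          (sampleRate n ε / 2 ^ (i + 1)) =
          ε ^ 2 / 4 * (sampleRate n ε / 2 ^ (i + 1)) * A.card := by
        field_simp
        ring
      rw [h3]
      unfold tolerance sampleRate
      field_simp
      ring
    rw [key, neg_le_neg_iff]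
    have : 0 ≤ (b : ℝ) * Real.log n := by positivity
    norm_num
    nlinarith

/-- Number of traces times failure probability. As `3b + 5 ≤ 7b` for `b ≥ 2`, there remain a
geometric factor for the sum over `b` and `n ^ (-3)` to pay for `n ^ 2` classes. -/
theorem two_mul_pow_mul_inv_pow_le {n b : ℕ} (hn : 2 ≤ n) (hb : 2 ≤ b) :
    ((2 * n : ℕ) : ℝ) ^ (b + 1) * (2 * ((n : ℝ) ^ (7 * b))⁻¹) ≤
      2 * ((n : ℝ) ^ 3)⁻¹ * (1 / 2) ^ b := by
  have hnat : (2 * n) ^ (b + 1) * (n ^ 3 * 2 ^ b) ≤ n ^ (7 * b) := by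
    calc (2 * n) ^ (b + 1) * (n ^ 3 * 2 ^ b) ≤ (n * n) ^ (b + 1) * (n ^ 3 * n ^ b) := by gcongr
      _ = n ^ (3 * b + 5) := by ring
      _ ≤ n ^ (7 * b) := Nat.pow_le_pow_right (by omega) (by omega)
  have hreal : ((2 * n : ℕ) : ℝ) ^ (b + 1) * ((n : ℝ) ^ 3 * 2 ^ b) ≤ (n : ℝ) ^ (7 * b) := by
    exact_mod_cast hnat
  have hpos : (0 : ℝ) < n := by positivity
  have e1 : 2 * ((n : ℝ) ^ 3)⁻¹ * (1 / 2) ^ b = 2 / ((n : ℝ) ^ 3 * 2 ^ b) := by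
    rw [one_div, inv_pow]; field_simp
  have e2 : ((2 * n : ℕ) : ℝ) ^ (b + 1) * (2 * ((n : ℝ) ^ (7 * b))⁻¹) =
      2 * ((2 * n : ℕ) : ℝ) ^ (b + 1) / (n : ℝ) ^ (7 * b) := by
    field_simp
  rw [e1, e2, div_le_div_iff₀ (by positivity) (by positivity)]
  linarith

/-- The indices of the nonempty connectivity classes. -/
noncomputable def classIndices (G : Graph α β) [Fintype E(G)] : Finset ℕ :=
  (Finset.univ.image (edgeConn G)).image (Nat.log 2)

/-- Some connectivity class deviates by more than its tolerance. -/
def deviationEvent (G : Graph α β) [Fintype V(G)] [Fintype E(G)] (ε : ℝ) (l : E(G) → ℕ) :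
    Set (E(G) → Bool) :=
  ⋃ i ∈ classIndices G, ⋃ b ∈ Finset.Ico 2 (4 * Fintype.card E(G) + 1), ⋃ A ∈ traces l i b,
    {ω | tolerance (Fintype.card V(G)) ε i b A < |deviation (sampleProbI G ε) A ω|}

theorem measure_deviationEvent_le [G.Loopless] {ε : ℝ} (hε : 0 < ε) (hε1 : ε ≤ 1)
    {l : E(G) → ℕ} (hl : IsForestLevel G l) (hn : 2 ≤ Fintype.card V(G)) :
    (sampleLaw G ε).real (deviationEvent G ε l) ≤ 4 / Fintype.card V(G) := by
  set n := Fintype.card V(G) with hn'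
  have hnpos : (0 : ℝ) < n := by positivity
  have hgeom : ∀ B : Finset ℕ, ∑ b ∈ B, ((1 : ℝ) / 2) ^ b ≤ 2 := fun B =>
    (summable_geometric_two.sum_le_tsum B fun b _ => by positivity).trans_eq tsum_geometric_two
  have hclass : ∀ i, (sampleLaw G ε).real (⋃ b ∈ Finset.Ico 2 (4 * Fintype.card E(G) + 1),
      ⋃ A ∈ traces l i b, {ω | tolerance n ε i b A <
        |deviation (sampleProbI G ε) A ω|}) ≤ 4 * ((n : ℝ) ^ 3)⁻¹ := by
    intro i
    calc _ ≤ ∑ b ∈ Finset.Ico 2 (4 * Fintype.card E(G) + 1),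
          (sampleLaw G ε).real (⋃ A ∈ traces l i b, {ω | tolerance n ε i b A <
            |deviation (sampleProbI G ε) A ω|}) := measureReal_biUnion_finset_le _ _
      _ ≤ ∑ b ∈ Finset.Ico 2 (4 * Fintype.card E(G) + 1),
          2 * ((n : ℝ) ^ 3)⁻¹ * (1 / 2) ^ b := by
          refine Finset.sum_le_sum fun b hb => ?_
          refine (measureReal_biUnion_finset_le _ _).trans ?_
          refine (Finset.sum_le_card_nsmul _ _ (2 * ((n : ℝ) ^ (7 * b))⁻¹) fun A hA => ?_).trans ?_
          · obtain ⟨S, -, rfl⟩ := Finset.mem_image.1 hA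
            exact measure_tolerance_lt_le hε hε1 Finset.inter_subset_right hn
          · rw [nsmul_eq_mul]
            refine le_trans ?_ (two_mul_pow_mul_inv_pow_le hn (Finset.mem_Ico.1 hb).1)
            refine mul_le_mul_of_nonneg_right ?_ (by positivity)
            exact_mod_cast card_traces_le hl i b (by omega)
      _ ≤ _ := by
          rw [← Finset.mul_sum]
          have := mul_le_mul_of_nonneg_left
            (hgeom (Finset.Ico 2 (4 * Fintype.card E(G) + 1)))
            (by positivity : (0 : ℝ) ≤ 2 * ((n : ℝ) ^ 3)⁻¹)
          linarith
  have hcard : ((classIndices G).card : ℝ) ≤ (n : ℝ) ^ 2 := by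
    exact_mod_cast Finset.card_image_le.trans card_image_edgeConn_le
  calc _ ≤ _ := measureReal_biUnion_finset_le _ _
    _ ≤ _ := Finset.sum_le_card_nsmul _ _ _ fun i _ => hclass i
    _ ≤ (n : ℝ) ^ 2 * (4 * ((n : ℝ) ^ 3)⁻¹) := by
        rw [nsmul_eq_mul]
        exact mul_le_mul_of_nonneg_right hcard (by positivity)
    _ = _ := by field_simp

omit [Fintype V(G)] in
theorem cutWeight_full (S : Set V(G)) :
    (Skeleton.full G).cutWeight S = (cutEdges G S).card := by
  simp [Skeleton.cutWeight, Skeleton.full, cutEdges]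

theorem cutWeight_sampledSkeleton_sub (ε : ℝ) (ω : E(G) → Bool) (S : Set V(G)) :
    (sampledSkeleton G ε ω).cutWeight S - (cutEdges G S).card =
      deviation (sampleProbI G ε) (cutEdges G S) ω := by
  simp only [deviation, Finset.sum_sub_distrib, Finset.sum_const, nsmul_eq_mul, mul_one]
  congr 1
  rw [cutEdges, ← Finset.sum_filter, Finset.filter_filter, Skeleton.cutWeight]
  refine Finset.sum_congr ?_ fun e _ => rfl
  ext e
  simp [sampledSkeleton, and_comm]

theorem abs_deviation_class_le [G.Loopless] {ε : ℝ} (hε : 0 < ε) {l : E(G) → ℕ}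
    (hl : IsForestLevel G l) {ω : E(G) → Bool} (hω : ω ∉ deviationEvent G ε l) {i : ℕ}
    (hi : i ∈ classIndices G) (S : Set V(G)) :
    |deviation (sampleProbI G ε) (cutEdges G S ∩ connClass G i) ω| ≤
      ε / 2 * ((cutEdges G S ∩ connClass G i).card +
        layerCut l i S / (3 + Real.logb 2 (Fintype.card V(G)))) := by
  have hγ := logb_two_nonneg (Fintype.card V(G))
  rcases (cutEdges G S ∩ connClass G i).eq_empty_or_nonempty with h0 | ⟨e, he⟩
  · rw [h0]
    simp only [deviation, Finset.sum_empty, abs_zero]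
    positivity
  rw [Finset.mem_inter] at he
  have h1 := hl.two_pow_le ((two_pow_le_edgeConn he.2).trans (edgeConn_le (mem_cutEdges.1 he.1)))
  set b := 4 * layerCut l i S / 2 ^ i with hb
  -- A cut meeting the class has at least `2 ^ i / 2` edges in the layer, so `b` is in the range
  -- covered by the union bound.
  have hb2 : 2 ≤ b := (Nat.le_div_iff_mul_le (by positivity)).2 (by omega)
  have hbE : b < 4 * Fintype.card E(G) + 1 := by
    have h2 : b ≤ 4 * layerCut l i S := Nat.div_le_self _ _
    have h3 : layerCut l i S ≤ Fintype.card E(G) := Finset.card_le_univ _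
    omega
  have hmul : (b : ℝ) * 2 ^ i ≤ 4 * layerCut l i S := by
    exact_mod_cast Nat.div_mul_le_self (4 * layerCut l i S) (2 ^ i)
  simp only [deviationEvent, Set.mem_iUnion, not_exists] at hω
  have h4 := hω i hi b (Finset.mem_Ico.2 ⟨hb2, hbE⟩) (cutEdges G S ∩ connClass G i)
    (Finset.mem_image.2 ⟨S, by simp [hb], rfl⟩)
  refine (not_lt.1 h4).trans ?_
  unfold tolerance
  gcongr ε / 2 * (_ + ?_)
  rw [div_le_div_iff₀ (by positivity) (by positivity)]
  nlinarith

/-- Over all classes, the class parts of the cut sum to its size and the layer parts to at most `3 +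
logb 2 n` times its size. Each of the two sums costs `ε / 2` of the cut. -/
theorem mem_approx_of_notMem_deviationEvent [G.Loopless] {ε : ℝ} (hε : 0 < ε) {l : E(G) → ℕ}
    (hl : IsForestLevel G l) {ω : E(G) → Bool} (hω : ω ∉ deviationEvent G ε l) :
    sampledSkeleton G ε ω ∈ approx G ε := by
  intro S
  set n := Fintype.card V(G)
  have hγ := logb_two_nonneg n
  have hmaps : ∀ e ∈ cutEdges G S, Nat.log 2 (edgeConn G e) ∈ classIndices G := fun e _ =>
    Finset.mem_image_of_mem _ (Finset.mem_image_of_mem _ (Finset.mem_univ e))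
  have hfilter : ∀ i, (cutEdges G S).filter (fun e => Nat.log 2 (edgeConn G e) = i) =
      cutEdges G S ∩ connClass G i := fun i => by
    ext e; simp [connClass]
  have hdev : deviation (sampleProbI G ε) (cutEdges G S) ω =
      ∑ i ∈ classIndices G, deviation (sampleProbI G ε) (cutEdges G S ∩ connClass G i) ω := by
    simp only [← hfilter]
    exact (Finset.sum_fiberwise_of_maps_to hmaps _).symm
  have hcard : ((cutEdges G S).card : ℝ) =
      ∑ i ∈ classIndices G, ((cutEdges G S ∩ connClass G i).card : ℝ) := by
    simp only [← hfilter]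
    exact_mod_cast Finset.card_eq_sum_card_fiberwise hmaps
  have hlayers : ∑ i ∈ classIndices G, (layerCut l i S : ℝ) ≤
      (cutEdges G S).card * (3 + Real.logb 2 n) := by
    have h1 : ∑ i ∈ classIndices G, (layerCut l i S : ℝ) ≤
        (cutEdges G S).card * ((Nat.log 2 n : ℕ) + 2) := by
      exact_mod_cast sum_layerCut_le l (classIndices G) S
    have h2 : (Nat.log 2 n : ℝ) ≤ Real.logb 2 n := by
      exact_mod_cast Real.natLog_le_logb n 2
    exact h1.trans (mul_le_mul_of_nonneg_left (by linarith) (Nat.cast_nonneg _))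
  have habs : |deviation (sampleProbI G ε) (cutEdges G S) ω| ≤ ε * (cutEdges G S).card := by
    rw [hdev]
    calc _ ≤ ∑ i ∈ classIndices G,
          |deviation (sampleProbI G ε) (cutEdges G S ∩ connClass G i) ω| :=
          Finset.abs_sum_le_sum_abs _ _
      _ ≤ ∑ i ∈ classIndices G, ε / 2 * ((cutEdges G S ∩ connClass G i).card +
          layerCut l i S / (3 + Real.logb 2 n)) :=
          Finset.sum_le_sum fun i hi => abs_deviation_class_le hε hl hω hi S
      _ = ε / 2 * ((cutEdges G S).card +
          (∑ i ∈ classIndices G, (layerCut l i S : ℝ)) / (3 + Real.logb 2 n)) := by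
          rw [← Finset.mul_sum, Finset.sum_add_distrib, ← hcard, Finset.sum_div]
      _ ≤ ε / 2 * ((cutEdges G S).card + (cutEdges G S).card) := by
          gcongr
          rw [div_le_iff₀ (by positivity)]
          exact hlayers
      _ = _ := by ring
  rw [← cutWeight_sampledSkeleton_sub, abs_le] at habs
  rw [cutWeight_full]
  constructor <;> linarith [habs.1, habs.2]

theorem measure_notMem_approx_le [G.Loopless] {ε : ℝ} (hε : 0 < ε) (hε1 : ε ≤ 1) :
    (sampleLaw G ε).real {ω | sampledSkeleton G ε ω ∉ approx G ε} ≤ 4 / Fintype.card V(G) := by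
  obtain ⟨l, hl⟩ := exists_forest_level G
  have hsub : {ω | sampledSkeleton G ε ω ∉ approx G ε} ⊆ deviationEvent G ε l := fun ω hω => by
    by_contra h
    exact hω (mem_approx_of_notMem_deviationEvent hε hl h)
  have : IsProbabilityMeasure (sampleLaw G ε) := by
    rw [sampleLaw_eq_coinLaw]; infer_instance
  -- The estimate of the event needs `n ≥ 2`, which an edge provides; without edges the event is
  -- empty.
  rcases isEmpty_or_nonempty E(G) with h | ⟨⟨e₀⟩⟩
  · have hempty : deviationEvent G ε l = ∅ := by
      simp [deviationEvent, classIndices]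
    rw [hempty] at hsub
    rw [Set.subset_empty_iff.1 hsub, measureReal_empty]
    positivity
  · exact (measureReal_mono hsub).trans
      (measure_deviationEvent_le hε hε1 hl (two_le_card_of_edge e₀))

end Sampling

end CutSparsifier

theorem mainTheorem1 :
    ∃ (C D : ℝ) (d : ℕ), 0 < C ∧ 0 < D ∧ 1 ≤ d ∧
      ∀ (α : Type u) (β : Type v) (G : Graph α β) [Fintype V(G)] [Fintype E(G)] [G.Loopless]
        (n : ℕ), n = Fintype.card V(G) → 1 ≤ n → ∀ ε : ℝ, 0 < ε → ε ≤ 1 →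
        (∫ ω, ((CutSparsifier.sampledSkeleton G ε ω).edges.ncard : ℝ)
            ∂CutSparsifier.sampleLaw G ε) ≤ C * (n * Real.log n ^ 2 / ε ^ 2) ∧
        (CutSparsifier.sampleLaw G ε).real
            {ω | CutSparsifier.sampledSkeleton G ε ω ∉ CutSparsifier.approx G ε} ≤
          D / (n : ℝ) ^ d := by
  refine ⟨1600, 4, 1, by norm_num, by norm_num, le_rfl, ?_⟩
  rintro α β G _ _ _ n rfl - ε hε hε1
  refine ⟨CutSparsifier.integral_ncard_edges_le hε, ?_⟩
  rw [pow_one]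
  exact CutSparsifier.measure_notMem_approx_le hε hε1
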